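/- Let $R$ be an associative ring with identity and let $k$ be an integer whose image in $R$ is a unit. For a ring $S$ let $GL(S)=\bigcup_n GL_n(S)$ be the stable general linear group, formed along the embeddings $\alpha\mapsto\begin{pmatrix}\alpha&0\\0&1\end{pmatrix}$; let $E(S)=\bigcup_n E_n(S)$ be the (normal) subgroup, where $E_n(S)$ is generated by the matrices $I+\lambda e_{ij}$ with $i\neq j$, $\lambda\in S$; and let $K_1(S)=GL(S)/E(S)$. Let $NK_1(R)=\ker\bigl(K_1(R[X])\to K_1(R)\bigr)$, where the map is induced by the ring homomorphism $R[X]\to R$, $X\mapsto 0$. Then $NK_1(R)$ has no $k$-torsion: if $x\in NK_1(R)$ satisfies $x^k=1$, then $x=1$. -/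

import Mathlib

noncomputable section

namespace WhiteheadK

universe u v

/-! ### Stabilization `GL_n(R) → GL_m(R)` for `n ≤ m` -/

/-- The matrix `A ⊥ I_{m-n}` (for `n ≤ m`): it agrees with `A` in the upper left `n × n` corner
and with the identity matrix elsewhere. -/
def stabMatrix {R : Type u} [Ring R] {n : ℕ} (m : ℕ) (A : Matrix (Fin n) (Fin n) R) :
    Matrix (Fin m) (Fin m) R :=
  fun i j => if h : i.1 < n ∧ j.1 < n then A ⟨i.1, h.1⟩ ⟨j.1, h.2⟩ else if i = j then 1 else 0

theorem stabMatrix_one {R : Type u} [Ring R] (n m : ℕ) :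
    stabMatrix m (1 : Matrix (Fin n) (Fin n) R) = 1 := by
  ext i j
  simp only [stabMatrix, Matrix.one_apply, Fin.ext_iff]
  split_ifs <;> rfl

theorem stabMatrix_mul {R : Type u} [Ring R] {n m : ℕ} (h : n ≤ m)
    (A B : Matrix (Fin n) (Fin n) R) :
    stabMatrix m (A * B) = stabMatrix m A * stabMatrix m B := by
  obtain ⟨d, rfl⟩ := Nat.exists_eq_add_of_le h
  have h₁ : ∀ (M : Matrix (Fin n) (Fin n) R) (i j : Fin n),
      stabMatrix (n + d) M (Fin.castAdd d i) (Fin.castAdd d j) = M i j := by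
    intro M i j
    simp [stabMatrix]
  have h₂ : ∀ (M : Matrix (Fin n) (Fin n) R) (i : Fin n) (j : Fin d),
      stabMatrix (n + d) M (Fin.castAdd d i) (Fin.natAdd n j) = 0 := by
    intro M i j
    have : (i : ℕ) ≠ n + j := by omega
    simp [stabMatrix, Fin.ext_iff, this]
  have h₃ : ∀ (M : Matrix (Fin n) (Fin n) R) (i : Fin d) (j : Fin n),
      stabMatrix (n + d) M (Fin.natAdd n i) (Fin.castAdd d j) = 0 := by
    intro M i j
    have : n + (i : ℕ) ≠ j := by omega
    simp [stabMatrix, Fin.ext_iff, this]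
  have h₄ : ∀ (M : Matrix (Fin n) (Fin n) R) (i j : Fin d),
      stabMatrix (n + d) M (Fin.natAdd n i) (Fin.natAdd n j) = if i = j then 1 else 0 := by
    intro M i j
    simp [stabMatrix, Fin.ext_iff]
  ext i j
  rw [Matrix.mul_apply, Fin.sum_univ_add]
  refine Fin.addCases (fun i => ?_) (fun i => ?_) i <;>
    refine Fin.addCases (fun j => ?_) (fun j => ?_) j <;>
    simp [h₁, h₂, h₃, h₄, Matrix.mul_apply]

/-- The embedding `GL_n(R) → GL_m(R)`, `α ↦ α ⊥ I_{m-n}`, for `n ≤ m`. -/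
def stab (R : Type u) [Ring R] (n m : ℕ) (h : n ≤ m) :
    Matrix.GeneralLinearGroup (Fin n) R →* Matrix.GeneralLinearGroup (Fin m) R :=
  Units.map
    { toFun := stabMatrix m
      map_one' := stabMatrix_one n m
      map_mul' := stabMatrix_mul h }

instance (R : Type u) [Ring R] :
    DirectedSystem (fun n : ℕ => Matrix.GeneralLinearGroup (Fin n) R)
      (fun n m h => stab R n m h) where
  map_self n x := by
    ext i j
    simp [stab, stabMatrix]
  map_map k j i hij hjk x := by
    ext a b
    simp only [stab, Units.coe_map, MonoidHom.coe_mk, OneHom.coe_mk, stabMatrix, Fin.ext_iff]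
    split_ifs <;> first | rfl | omega

/-- The stable general linear group `GL(R) = ⋃ GL_n(R)`: the direct limit of the groups `GL_n(R)`
along the embeddings `α ↦ α ⊥ I`. -/
abbrev StableGL (R : Type u) [Ring R] : Type u :=
  DirectLimit (fun n : ℕ => Matrix.GeneralLinearGroup (Fin n) R) (fun n m h => stab R n m h)

/-- The canonical map `GL_n(R) → GL(R)`. -/
def toStable (R : Type u) [Ring R] (n : ℕ) :
    Matrix.GeneralLinearGroup (Fin n) R →* StableGL R where
  toFun g := ⟦⟨n, g⟩⟧
  map_one' := (DirectLimit.one_def (f := fun n m h => stab R n m h) n).symm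
  map_mul' x y := (DirectLimit.mul_def (f := fun n m h => stab R n m h) n x y).symm

theorem toStable_stab (R : Type u) [Ring R] {n m : ℕ} (h : n ≤ m)
    (g : Matrix.GeneralLinearGroup (Fin n) R) :
    toStable R m (stab R n m h g) = toStable R n g :=
  (DirectLimit.eq_of_le (F := fun n : ℕ => Matrix.GeneralLinearGroup (Fin n) R)
    (f := fun n m h => stab R n m h) ⟨n, g⟩ m h).symm

/-! ### Elementary matrices -/

/-- `E_n(R)`: the subgroup of `GL_n(R)` generated by the matrices `I + λ e_{ij}`, `i ≠ j`. -/
def elementary (R : Type u) [Ring R] (n : ℕ) :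
    Subgroup (Matrix.GeneralLinearGroup (Fin n) R) :=
  Subgroup.closure {g | ∃ (i j : Fin n) (c : R), i ≠ j ∧
    (g : Matrix (Fin n) (Fin n) R) = 1 + Matrix.single i j c}

theorem stab_mem_elementary {R : Type u} [Ring R] {n m : ℕ} (h : n ≤ m)
    {g : Matrix.GeneralLinearGroup (Fin n) R} (hg : g ∈ elementary R n) :
    stab R n m h g ∈ elementary R m := by
  suffices elementary R n ≤ (elementary R m).comap (stab R n m h) from this hg
  refine (Subgroup.closure_le _).2 ?_
  rintro g ⟨i, j, c, hij, hg⟩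
  refine Subgroup.subset_closure ⟨Fin.castLE h i, Fin.castLE h j, c, ?_, ?_⟩
  · intro e
    exact hij (Fin.castLE_injective h e)
  · ext a b
    simp only [stab, Units.coe_map, MonoidHom.coe_mk, OneHom.coe_mk, hg, stabMatrix,
      Matrix.add_apply, Matrix.one_apply, Matrix.single_apply, Fin.ext_iff, Fin.val_castLE]
    have := i.2
    have := j.2
    split_ifs <;> first | rfl | omega | simp

/-- `E(R) = ⋃ E_n(R)`, as a subgroup of `GL(R)`. -/
def stableE (R : Type u) [Ring R] : Subgroup (StableGL R) where
  carrier := {x | ∃ n, ∃ g ∈ elementary R n, toStable R n g = x}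
  one_mem' := ⟨0, 1, one_mem _, map_one _⟩
  mul_mem' := by
    rintro _ _ ⟨n, g, hg, rfl⟩ ⟨m, g', hg', rfl⟩
    refine ⟨max n m, stab R n _ (le_max_left n m) g * stab R m _ (le_max_right n m) g',
      mul_mem (stab_mem_elementary _ hg) (stab_mem_elementary _ hg'), ?_⟩
    rw [map_mul, toStable_stab, toStable_stab]
  inv_mem' := by
    rintro _ ⟨n, g, hg, rfl⟩
    exact ⟨n, g⁻¹, inv_mem hg, map_inv _ _⟩

/-! ### Normality of `E(R)` in `GL(R)`, needed to form the quotient group -/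

theorem exists_elementary_unit {R : Type u} [Ring R] {n : ℕ} {i j : Fin n} (hij : i ≠ j) (c : R) :
    ∃ g ∈ elementary R n, (g : Matrix (Fin n) (Fin n) R) = 1 + Matrix.single i j c := by
  have h : ∀ c d : R, c + d = 0 →
      (1 + Matrix.single i j c) * (1 + Matrix.single i j d) = (1 : Matrix (Fin n) (Fin n) R) := by
    intro c d hcd
    rw [mul_add, add_mul, add_mul, Matrix.single_mul_single_of_ne _ _ _ _ hij.symm]
    simp [add_assoc, ← Matrix.single_add, hcd]
  exact ⟨⟨1 + Matrix.single i j c, 1 + Matrix.single i j (-c), h _ _ (by simp), h _ _ (by simp)⟩,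
    Subgroup.subset_closure ⟨i, j, c, hij, rfl⟩, rfl⟩

theorem exists_elementary_col {R : Type u} [Ring R] {n : ℕ} (u : Fin n → R)
    (s : Finset (Fin n)) :
    ∃ g ∈ elementary R (n + 1), (g : Matrix (Fin (n + 1)) (Fin (n + 1)) R) =
      1 + ∑ a ∈ s, Matrix.single a.castSucc (Fin.last n) (u a) := by
  induction s using Finset.induction_on with
  | empty => exact ⟨1, one_mem _, by simp⟩
  | insert a s ha ih =>
    obtain ⟨g, hg, hg'⟩ := ih
    obtain ⟨e, he, he'⟩ := exists_elementary_unit (Fin.castSucc_lt_last a).ne (u a)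
    refine ⟨e * g, mul_mem he hg, ?_⟩
    have h : Matrix.single a.castSucc (Fin.last n) (u a) * ∑ x ∈ s, Matrix.single x.castSucc (Fin.last n) (u x) = 0 := by
      rw [Finset.mul_sum]
      exact Finset.sum_eq_zero fun x _ =>
        Matrix.single_mul_single_of_ne _ _ _ _ (Fin.castSucc_lt_last x).ne' _
    rw [Units.val_mul, hg', he', Finset.sum_insert ha, add_mul, mul_add, mul_add, h]
    simp only [mul_one, one_mul, add_zero]
    abel

theorem exists_elementary_row {R : Type u} [Ring R] {n : ℕ} (v : Fin n → R)
    (s : Finset (Fin n)) :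
    ∃ g ∈ elementary R (n + 1), (g : Matrix (Fin (n + 1)) (Fin (n + 1)) R) =
      1 + ∑ a ∈ s, Matrix.single (Fin.last n) a.castSucc (v a) := by
  induction s using Finset.induction_on with
  | empty => exact ⟨1, one_mem _, by simp⟩
  | insert a s ha ih =>
    obtain ⟨g, hg, hg'⟩ := ih
    obtain ⟨e, he, he'⟩ := exists_elementary_unit (Fin.castSucc_lt_last a).ne' (v a)
    refine ⟨e * g, mul_mem he hg, ?_⟩
    have h : Matrix.single (Fin.last n) a.castSucc (v a) * ∑ x ∈ s, Matrix.single (Fin.last n) x.castSucc (v x) = 0 := by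
      rw [Finset.mul_sum]
      exact Finset.sum_eq_zero fun x _ =>
        Matrix.single_mul_single_of_ne _ _ _ _ (Fin.castSucc_lt_last a).ne _
    rw [Units.val_mul, hg', he', Finset.sum_insert ha, add_mul, mul_add, mul_add, h]
    simp only [mul_one, one_mul, add_zero]
    abel

/-- If `v` is a row and `u` a column with `v u = 0`, then `(I + u v) ⊥ 1` is elementary. -/
theorem stab_mem_elementary_of_eq {R : Type u} [Ring R] {n : ℕ}
    (x : Matrix.GeneralLinearGroup (Fin n) R) (a b : Fin n → R) (hab : ∑ l, b l * a l = 0)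
    (hx : (x : Matrix (Fin n) (Fin n) R) = 1 + Matrix.of fun p q => a p * b q) :
    stab R n (n + 1) n.le_succ x ∈ elementary R (n + 1) := by
  obtain ⟨g₁, hg₁, e₁⟩ := exists_elementary_col a Finset.univ
  obtain ⟨g₂, hg₂, e₂⟩ := exists_elementary_row b Finset.univ
  obtain ⟨g₃, hg₃, e₃⟩ := exists_elementary_col (fun p => - a p) Finset.univ
  obtain ⟨g₄, hg₄, e₄⟩ := exists_elementary_row (fun p => - b p) Finset.univ
  set X : Matrix (Fin (n + 1)) (Fin (n + 1)) R :=
    ∑ p, Matrix.single p.castSucc (Fin.last n) (a p) with hX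
  set Y : Matrix (Fin (n + 1)) (Fin (n + 1)) R :=
    ∑ p, Matrix.single (Fin.last n) p.castSucc (b p) with hY
  have e₃' : (g₃ : Matrix (Fin (n + 1)) (Fin (n + 1)) R) = 1 - X := by
    rw [e₃, sub_eq_add_neg, hX, ← Finset.sum_neg_distrib]
    simp only [Matrix.single_neg]
  have e₄' : (g₄ : Matrix (Fin (n + 1)) (Fin (n + 1)) R) = 1 - Y := by
    rw [e₄, sub_eq_add_neg, hY, ← Finset.sum_neg_distrib]
    simp only [Matrix.single_neg]
  have hXX : X * X = 0 := by
    rw [hX, Finset.sum_mul]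
    refine Finset.sum_eq_zero fun p _ => ?_
    rw [Finset.mul_sum]
    exact Finset.sum_eq_zero fun q _ =>
      Matrix.single_mul_single_of_ne _ _ _ _ (Fin.castSucc_lt_last q).ne' _
  have hYY : Y * Y = 0 := by
    rw [hY, Finset.sum_mul]
    refine Finset.sum_eq_zero fun p _ => ?_
    rw [Finset.mul_sum]
    exact Finset.sum_eq_zero fun q _ =>
      Matrix.single_mul_single_of_ne _ _ _ _ (Fin.castSucc_lt_last p).ne _
  have hYX : Y * X = 0 := by
    have h : ∀ p ∈ (Finset.univ : Finset (Fin n)),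
        Matrix.single (Fin.last n) p.castSucc (b p) * X =
          Matrix.single (Fin.last n) (Fin.last n) (b p * a p) := by
      intro p _
      rw [hX, Finset.mul_sum, Finset.sum_eq_single p]
      · rw [Matrix.single_mul_single_same]
      · intro q _ hq
        exact Matrix.single_mul_single_of_ne _ _ _ _
          (fun h => hq (Fin.castSucc_injective n h).symm) _
      · simp
    rw [hY, Finset.sum_mul, Finset.sum_congr rfl h]
    ext p q
    rw [Matrix.sum_apply]
    simp only [Matrix.single_apply, Matrix.zero_apply]
    split_ifs
    · exact hab
    · simp
  have hXY : ∀ p q, (X * Y) (Fin.castSucc p) (Fin.castSucc q) = a p * b q := by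
    intro p q
    simp [hX, hY, Matrix.mul_apply, Matrix.sum_apply, Matrix.single_apply, Fin.sum_univ_castSucc,
      (Fin.castSucc_lt_last _).ne']
  have hXl : ∀ q, (X * Y) (Fin.last n) q = 0 := by
    intro q
    simp [hX, Matrix.mul_apply, Matrix.sum_apply]
  have hYl : ∀ p, (X * Y) p (Fin.last n) = 0 := by
    intro q
    simp [hY, Matrix.mul_apply, Matrix.sum_apply]
  have key : stab R n (n + 1) n.le_succ x = g₁ * g₂ * g₃ * g₄ := by
    have hr : (1 + X) * (1 + Y) * (1 - X) * (1 - Y) = 1 + X * Y := by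
      have h1 : (1 + X) * (1 + Y) * (1 - X) * (1 - Y) = 1 + X * Y - (1 - Y) * 0
          + (-(X * X) - Y * X - X * (Y * X)) * (1 - Y) - Y * Y - X * (Y * Y) := by noncomm_ring
      rw [h1, hXX, hYX, hYY]
      simp
    ext1
    rw [Units.val_mul, Units.val_mul, Units.val_mul, e₁, e₂, e₃', e₄', hr]
    ext p q
    rw [Matrix.add_apply]
    refine Fin.lastCases ?_ (fun p => ?_) p <;> refine Fin.lastCases ?_ (fun q => ?_) q
    · simp [hXl, stab, stabMatrix]
    · simp [hXl, stab, stabMatrix, Matrix.one_apply]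
    · simp [hYl, stab, stabMatrix]
    · simp [hXY, stab, stabMatrix, Matrix.one_apply, hx]
  rw [key]
  exact mul_mem (mul_mem (mul_mem hg₁ hg₂) hg₃) hg₄

theorem conj_mem_stableE {R : Type u} [Ring R] {n : ℕ}
    (g e : Matrix.GeneralLinearGroup (Fin n) R) (he : e ∈ elementary R n) :
    toStable R n (g * e * g⁻¹) ∈ stableE R := by
  suffices elementary R n ≤ (stableE R).comap ((toStable R n).comp (MulAut.conj g).toMonoidHom)
    from this he
  refine (Subgroup.closure_le _).2 ?_
  rintro e ⟨i, j, c, hij, he⟩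
  change toStable R n (g * e * g⁻¹) ∈ stableE R
  refine ⟨n + 1, stab R n (n + 1) n.le_succ (g * e * g⁻¹), ?_, toStable_stab R _ _⟩
  refine stab_mem_elementary_of_eq _
    (fun p => (g : Matrix (Fin n) (Fin n) R) p i * c)
    (fun q => ((g⁻¹ : Matrix.GeneralLinearGroup (Fin n) R) : Matrix (Fin n) (Fin n) R) j q) ?_ ?_
  · have h : (((g⁻¹ : Matrix.GeneralLinearGroup (Fin n) R) : Matrix (Fin n) (Fin n) R) *
        (g : Matrix (Fin n) (Fin n) R)) j i = 0 := by
      rw [Units.inv_mul, Matrix.one_apply_ne hij.symm]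
    simp only [← mul_assoc]
    rw [← Finset.sum_mul, ← Matrix.mul_apply, h, zero_mul]
  · rw [Units.val_mul, Units.val_mul, he, mul_add, add_mul, mul_one, Units.mul_inv]
    congr 1
    ext p q
    simp [Matrix.mul_apply, Matrix.single_apply, ite_and]

instance stableE_normal (R : Type u) [Ring R] : (stableE R).Normal where
  conj_mem := by
    rintro _ ⟨n, e, he, rfl⟩ y
    induction y using DirectLimit.induction with
    | ih m g =>
      change toStable R m g * toStable R n e * (toStable R m g)⁻¹ ∈ stableE R
      rw [← toStable_stab R (le_max_left n m) e, ← toStable_stab R (le_max_right n m) g,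
        ← map_inv, ← map_mul, ← map_mul]
      exact conj_mem_stableE _ _ (stab_mem_elementary _ he)

/-! ### The groups `K₁` and `NK₁` -/

/-- The Whitehead group `K₁(R) = GL(R) / E(R)`, written multiplicatively. -/
abbrev K1 (R : Type u) [Ring R] : Type u :=
  StableGL R ⧸ stableE R

/-- The map `GL_n(R) → GL_n(S)` that applies a ring homomorphism to every entry. -/
def glMap {R : Type u} {S : Type v} [Ring R] [Ring S] (f : R →+* S) (n : ℕ) :
    Matrix.GeneralLinearGroup (Fin n) R →* Matrix.GeneralLinearGroup (Fin n) S :=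
  Units.map (f.mapMatrix (m := Fin n)).toMonoidHom

theorem stab_glMap {R : Type u} {S : Type v} [Ring R] [Ring S] (f : R →+* S) (n m : ℕ)
    (h : n ≤ m) (g : Matrix.GeneralLinearGroup (Fin n) R) :
    stab S n m h (glMap f n g) = glMap f m (stab R n m h g) := by
  ext i j
  change stabMatrix m ((g : Matrix (Fin n) (Fin n) R).map f) i j =
    f (stabMatrix m (g : Matrix (Fin n) (Fin n) R) i j)
  simp only [stabMatrix, Matrix.map_apply]
  split_ifs <;> simp

/-- The map `GL(R) → GL(S)` induced by a ring homomorphism. -/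
def stableGLMap {R : Type u} {S : Type v} [Ring R] [Ring S] (f : R →+* S) :
    StableGL R →* StableGL S where
  toFun := DirectLimit.map (fun n m h => stab R n m h) (fun n m h => stab S n m h)
    (fun n => glMap f n) (stab_glMap f)
  map_one' := by
    rw [DirectLimit.one_def 0]
    change toStable S 0 (glMap f 0 1) = 1
    rw [map_one, map_one]
  map_mul' x y := by
    induction x, y using DirectLimit.induction₂ with
    | ih n x y =>
      change _ = toStable S n (glMap f n x) * toStable S n (glMap f n y)
      rw [← map_mul, ← map_mul, DirectLimit.mul_def]
      rfl

theorem glMap_mem_elementary {R : Type u} {S : Type v} [Ring R] [Ring S] (f : R →+* S) {n : ℕ}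
    {g : Matrix.GeneralLinearGroup (Fin n) R} (hg : g ∈ elementary R n) :
    glMap f n g ∈ elementary S n := by
  suffices elementary R n ≤ (elementary S n).comap (glMap f n) from this hg
  refine (Subgroup.closure_le _).2 ?_
  rintro g ⟨i, j, c, hij, hg⟩
  refine Subgroup.subset_closure ⟨i, j, f c, hij, ?_⟩
  ext a b
  simp [glMap, hg, Matrix.one_apply, Matrix.single_apply, apply_ite f]

theorem stableE_le_comap {R : Type u} {S : Type v} [Ring R] [Ring S] (f : R →+* S) :
    stableE R ≤ (stableE S).comap (stableGLMap f) := by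
  rintro _ ⟨n, g, hg, rfl⟩
  exact ⟨n, glMap f n g, glMap_mem_elementary f hg, rfl⟩

/-- The homomorphism `K₁(R) → K₁(S)` induced by a ring homomorphism. -/
def K1.map {R : Type u} {S : Type v} [Ring R] [Ring S] (f : R →+* S) : K1 R →* K1 S :=
  QuotientGroup.map (stableE R) (stableE S) (stableGLMap f) (stableE_le_comap f)

/-- `NK₁(R) = ker (K₁(R[X]) → K₁(R))`, the map being induced by the ring homomorphism
`R[X] → R`, `X ↦ 0` (that is, by taking constant coefficients). -/
def NK1 (R : Type u) [Ring R] : Subgroup (K1 (Polynomial R)) :=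
  (K1.map (Polynomial.constantCoeff : Polynomial R →+* R)).ker

end WhiteheadK

end

open PowerSeries in
/-- If `k` is invertible, then `1 - X` has a `k`-th root with constant coefficient `1`. -/
theorem PowerSeries.exists_pow_eq_one_sub_X {C : Type*} [CommRing C] (k : ℕ) (hk : IsUnit (k : C)) :
    ∃ f : C⟦X⟧, f ^ k = 1 - X ∧ constantCoeff f = 1 := by
  rcases subsingleton_or_nontrivial C with hC | hC
  · exact ⟨1, Subsingleton.elim _ _, map_one _⟩
  have hk0 : k ≠ 0 := by
    rintro rfl
    simp at hk
  have hen : HenselianRing C⟦X⟧ (.span {X}) := inferInstance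
  obtain ⟨f, hf, hf1⟩ := hen.is_henselian (Polynomial.X ^ k - Polynomial.C (1 - X))
    (Polynomial.monic_X_pow_sub_C _ hk0) 1
    (by simp)
    (by
      simp only [Polynomial.derivative_sub, Polynomial.derivative_X_pow, Polynomial.derivative_C]
      simpa using (hk.map (PowerSeries.C : C →+* C⟦X⟧)).map (Ideal.Quotient.mk (.span {X})))
  refine ⟨f, by simpa [sub_eq_zero] using hf, ?_⟩
  rw [Ideal.mem_span_singleton, X_dvd_iff] at hf1
  simpa [sub_eq_zero] using hf1

/-- The value of a power series at a nilpotent element. -/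
noncomputable def PowerSeries.nilEval {C A : Type*} [CommRing C] [Ring A] [Algebra C A] (f : PowerSeries C)
    (P : A) : A :=
  ∑ i ∈ Finset.range (nilpotencyClass P), PowerSeries.coeff i f • P ^ i

namespace PowerSeries

variable {C A : Type*} [CommRing C] [Ring A] [Algebra C A]

theorem nilEval_eq_sum (f : PowerSeries C) {P : A} {m : ℕ} (h : P ^ m = 0) :
    f.nilEval P = ∑ i ∈ Finset.range m, coeff i f • P ^ i := by
  refine Finset.sum_subset (Finset.range_subset_range.2 (Nat.sInf_le h)) fun i _ hi => ?_
  rw [pow_eq_zero_of_le (not_lt.1 (Finset.mem_range.not.1 hi)) (pow_nilpotencyClass ⟨m, h⟩),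
    smul_zero]

theorem aeval_eq_nilEval (p : Polynomial C) {P : A} (hP : IsNilpotent P) :
    Polynomial.aeval P p = nilEval (p : PowerSeries C) P := by
  obtain ⟨m, h⟩ := hP
  have h' : P ^ (max m (p.natDegree + 1)) = 0 := pow_eq_zero_of_le (le_max_left _ _) h
  rw [nilEval_eq_sum _ h', Polynomial.aeval_eq_sum_range' (n := max m (p.natDegree + 1)) (by omega)]
  simp

theorem nilEval_trunc (f : PowerSeries C) {P : A} {m : ℕ} (h : P ^ m = 0) :
    nilEval (trunc m f : PowerSeries C) P = f.nilEval P := by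
  rw [nilEval_eq_sum _ h, nilEval_eq_sum _ h]
  refine Finset.sum_congr rfl fun i hi => ?_
  rw [coeff_coe_trunc_of_lt (Finset.mem_range.1 hi)]

theorem nilEval_mul (f g : PowerSeries C) {P : A} (hP : IsNilpotent P) :
    (f * g).nilEval P = f.nilEval P * g.nilEval P := by
  obtain ⟨m, h⟩ := hP
  rw [← nilEval_trunc f h, ← nilEval_trunc g h, ← aeval_eq_nilEval _ ⟨m, h⟩,
    ← aeval_eq_nilEval _ ⟨m, h⟩, ← map_mul, aeval_eq_nilEval _ ⟨m, h⟩,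
    ← nilEval_trunc (f * g) h, ← trunc_trunc_mul_trunc, ← Polynomial.coe_mul,
    nilEval_trunc _ h]

theorem nilEval_one {P : A} (hP : IsNilpotent P) : (1 : PowerSeries C).nilEval P = 1 := by
  simpa using (aeval_eq_nilEval (1 : Polynomial C) hP).symm

theorem nilEval_zero (f : PowerSeries C) : f.nilEval (0 : A) = constantCoeff f • 1 := by
  rw [nilEval_eq_sum f (pow_one (0 : A)), Finset.sum_range_one, pow_zero,
    coeff_zero_eq_constantCoeff_apply]

theorem nilEval_algHom {B : Type*} [Ring B] [Algebra C B] (f : PowerSeries C) (g : A →ₐ[C] B)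
    {P : A} (hP : IsNilpotent P) : f.nilEval (g P) = g (f.nilEval P) := by
  obtain ⟨m, hm⟩ := hP
  have hm' : g P ^ m = 0 := by rw [← map_pow, hm, map_zero]
  rw [nilEval_eq_sum f hm, nilEval_eq_sum f hm', map_sum]
  simp

theorem nilEval_pow (f : PowerSeries C) {P : A} (hP : IsNilpotent P) (k : ℕ) :
    (f ^ k).nilEval P = f.nilEval P ^ k := by
  induction k with
  | zero => simp [nilEval_one hP]
  | succ k ih => rw [pow_succ, pow_succ, nilEval_mul _ _ hP, ih]

theorem nilEval_one_sub_X {P : A} (hP : IsNilpotent P) :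
    (1 - X : PowerSeries C).nilEval P = 1 - P := by
  have h : ((1 - Polynomial.X : Polynomial C) : PowerSeries C) = 1 - X := by
    exact (map_sub (Polynomial.coeToPowerSeries.ringHom (R := C)) 1 Polynomial.X).trans (by simp)
  rw [← h, ← aeval_eq_nilEval _ hP]
  simp

theorem isUnit_nilEval {f : PowerSeries C} (hf : IsUnit (constantCoeff f)) {P : A} (hP : IsNilpotent P) :
    IsUnit (f.nilEval P) := by
  obtain ⟨u, rfl⟩ := isUnit_iff_constantCoeff.2 hf
  exact ⟨⟨nilEval u.1 P, nilEval u.2 P, by rw [← nilEval_mul _ _ hP, u.3, nilEval_one hP],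
    by rw [← nilEval_mul _ _ hP, u.4, nilEval_one hP]⟩, rfl⟩

theorem _root_.pow_mul_eq_mul_pow_of_mul_eq_mul {A : Type*} [Monoid A] {P Q U : A}
    (h : P * U = U * Q) (i : ℕ) : P ^ i * U = U * Q ^ i :=
  (SemiconjBy.pow_right (show SemiconjBy U Q P from h.symm) i).symm

theorem nilEval_mul_eq_mul_nilEval (f : PowerSeries C) {P Q U : A} (hP : IsNilpotent P)
    (hQ : IsNilpotent Q) (h : P * U = U * Q) : f.nilEval P * U = U * f.nilEval Q := by
  obtain ⟨m, hm⟩ := hP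
  obtain ⟨m', hm'⟩ := hQ
  rw [nilEval_eq_sum f (pow_eq_zero_of_le (le_max_left m m') hm),
    nilEval_eq_sum f (pow_eq_zero_of_le (le_max_right m m') hm'), Finset.sum_mul, Finset.mul_sum]
  refine Finset.sum_congr rfl fun i _ => ?_
  rw [smul_mul_assoc, pow_mul_eq_mul_pow_of_mul_eq_mul h, mul_smul_comm]

end PowerSeries

namespace Matrix

theorem exists_fromBlocks_upper_pow {m n S : Type*} [Fintype m] [Fintype n] [DecidableEq m]
    [DecidableEq n] [Ring S] (A : Matrix m m S) (B : Matrix m n S) (D : Matrix n n S) (i : ℕ) :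
    ∃ K, fromBlocks A B 0 D ^ i = fromBlocks (A ^ i) K 0 (D ^ i) := by
  induction i with
  | zero => exact ⟨0, by simp [fromBlocks_one]⟩
  | succ i ih =>
    obtain ⟨K, hK⟩ := ih
    exact ⟨A ^ i * B + K * D, by simp [pow_succ, hK, fromBlocks_multiply]⟩

theorem exists_nilEval_fromBlocks_upper {m n S C : Type*} [Fintype m] [Fintype n] [DecidableEq m]
    [DecidableEq n] [Ring S] [CommRing C] [Algebra C S] (f : PowerSeries C) {A : Matrix m m S}
    {B : Matrix m n S} {D : Matrix n n S} (h : IsNilpotent (fromBlocks A B 0 D)) :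
    IsNilpotent A ∧ IsNilpotent D ∧
      ∃ K, f.nilEval (fromBlocks A B 0 D) = fromBlocks (f.nilEval A) K 0 (f.nilEval D) := by
  obtain ⟨r, hr⟩ := h
  choose K hK using exists_fromBlocks_upper_pow A B D
  have hr' := hr
  rw [hK, ← fromBlocks_zero, fromBlocks_inj] at hr'
  refine ⟨⟨r, hr'.1⟩, ⟨r, hr'.2.2.2⟩, ∑ i ∈ Finset.range r, PowerSeries.coeff i f • K i, ?_⟩
  rw [PowerSeries.nilEval_eq_sum f hr, PowerSeries.nilEval_eq_sum f hr'.1,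
    PowerSeries.nilEval_eq_sum f hr'.2.2.2]
  simp only [hK, fromBlocks_smul]
  ext i j
  rcases i with i | i <;> rcases j with j | j <;> simp [Matrix.sum_apply]

end Matrix

namespace Matrix

theorem isUnit_submatrix_self {m n R : Type*} [Fintype m] [Fintype n] [DecidableEq m]
    [DecidableEq n] [Ring R] {M : Matrix m m R} (hM : IsUnit M) (e : n ≃ m) :
    IsUnit (M.submatrix e e) :=
  hM.map (reindexRingEquiv R e.symm)

variable {m n R : Type*} [Fintype m] [Fintype n] [DecidableEq m] [DecidableEq n] [Ring R]

theorem isUnit_fromBlocks_one_upper (B : Matrix m n R) :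
    IsUnit (fromBlocks 1 B 0 1 : Matrix (m ⊕ n) (m ⊕ n) R) :=
  ⟨⟨fromBlocks 1 B 0 1, fromBlocks 1 (-B) 0 1, by simp [fromBlocks_multiply],
    by simp [fromBlocks_multiply]⟩, rfl⟩

theorem isUnit_fromBlocks_one_lower (B : Matrix n m R) :
    IsUnit (fromBlocks 1 0 B 1 : Matrix (m ⊕ n) (m ⊕ n) R) :=
  ⟨⟨fromBlocks 1 0 B 1, fromBlocks 1 0 (-B) 1, by simp [fromBlocks_multiply],
    by simp [fromBlocks_multiply]⟩, rfl⟩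

theorem isUnit_fromBlocks_diagonal {A : Matrix m m R} {D : Matrix n n R} (hA : IsUnit A)
    (hD : IsUnit D) : IsUnit (fromBlocks A 0 0 D) := by
  obtain ⟨a, rfl⟩ := hA
  obtain ⟨d, rfl⟩ := hD
  exact ⟨⟨fromBlocks a 0 0 d, fromBlocks a.2 0 0 d.2,
    by simp [fromBlocks_multiply],
    by simp [fromBlocks_multiply]⟩, rfl⟩

theorem fromBlocks_upper_eq_mul {A : Matrix m m R} {B : Matrix m n R} {D : Matrix n n R}
    (hD : IsUnit D) :
    ∃ B', fromBlocks A B 0 D = fromBlocks 1 B' 0 1 * fromBlocks A 0 0 D := by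
  obtain ⟨d, rfl⟩ := hD
  exact ⟨B * d.2, by simp [fromBlocks_multiply, Matrix.mul_assoc]⟩

theorem fromBlocks_lower_eq_mul {A : Matrix m m R} {B : Matrix n m R} {D : Matrix n n R}
    (hA : IsUnit A) :
    ∃ B', fromBlocks A 0 B D = fromBlocks 1 0 B' 1 * fromBlocks A 0 0 D := by
  obtain ⟨a, rfl⟩ := hA
  exact ⟨B * a.2, by simp [fromBlocks_multiply, Matrix.mul_assoc]⟩

theorem isUnit_fromBlocks_upper {A : Matrix m m R} {B : Matrix m n R} {D : Matrix n n R}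
    (hA : IsUnit A) (hD : IsUnit D) : IsUnit (fromBlocks A B 0 D) := by
  obtain ⟨B', h⟩ := fromBlocks_upper_eq_mul (A := A) (B := B) hD
  rw [h]
  exact (isUnit_fromBlocks_one_upper B').mul (isUnit_fromBlocks_diagonal hA hD)

theorem isUnit_fromBlocks_lower {A : Matrix m m R} {B : Matrix n m R} {D : Matrix n n R}
    (hA : IsUnit A) (hD : IsUnit D) : IsUnit (fromBlocks A 0 B D) := by
  obtain ⟨B', h⟩ := fromBlocks_lower_eq_mul (B := B) (D := D) hA
  rw [h]
  exact (isUnit_fromBlocks_one_lower B').mul (isUnit_fromBlocks_diagonal hA hD)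

end Matrix

namespace WhiteheadK

open Matrix

/-- The class in `K₁(R)` of a matrix in `GL_n(R)`. -/
noncomputable def toK1 (R : Type*) [Ring R] (n : ℕ) :
    Matrix.GeneralLinearGroup (Fin n) R →* K1 R :=
  (QuotientGroup.mk' (stableE R)).comp (toStable R n)

variable {R : Type*} [Ring R]

theorem toK1_eq_one_iff {n : ℕ} {g : Matrix.GeneralLinearGroup (Fin n) R} :
    toK1 R n g = 1 ↔ toStable R n g ∈ stableE R :=
  QuotientGroup.eq_one_iff _

theorem toK1_eq_one {n : ℕ} {g : Matrix.GeneralLinearGroup (Fin n) R} (hg : g ∈ elementary R n) :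
    toK1 R n g = 1 :=
  toK1_eq_one_iff.2 ⟨n, g, hg, rfl⟩

theorem toK1_stab {n m : ℕ} (h : n ≤ m) (g : Matrix.GeneralLinearGroup (Fin n) R) :
    toK1 R m (stab R n m h g) = toK1 R n g :=
  congrArg _ (toStable_stab R h g)

theorem exists_toK1_eq (x : K1 R) : ∃ n g, toK1 R n g = x := by
  obtain ⟨y, rfl⟩ := QuotientGroup.mk_surjective x
  induction y using DirectLimit.induction with
  | ih m g => exact ⟨m, g, rfl⟩

theorem map_toK1 {S : Type*} [Ring S] (f : R →+* S) (n : ℕ)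
    (g : Matrix.GeneralLinearGroup (Fin n) R) :
    K1.map f (toK1 R n g) = toK1 S n (glMap f n g) :=
  rfl

theorem exists_elementary_block {n : ℕ} (s : Set (Fin n)) (B : Matrix (Fin n) (Fin n) R)
    (hB : ∀ i j, B i j ≠ 0 → i ∈ s ∧ j ∉ s) :
    ∃ g ∈ elementary R n, (g : Matrix (Fin n) (Fin n) R) = 1 + B := by
  suffices ∀ t : Finset (Fin n × Fin n), ∃ g ∈ elementary R n,
      (g : Matrix (Fin n) (Fin n) R) = 1 + ∑ p ∈ t, Matrix.single p.1 p.2 (B p.1 p.2) by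
    obtain ⟨g, hg, h⟩ := this Finset.univ
    refine ⟨g, hg, h.trans ?_⟩
    conv_rhs => rw [matrix_eq_sum_single B]
    rw [Fintype.sum_prod_type]
  intro t
  induction t using Finset.induction_on with
  | empty => exact ⟨1, one_mem _, by simp⟩
  | insert p t hp ih =>
    obtain ⟨g, hg, h⟩ := ih
    by_cases hp0 : B p.1 p.2 = 0
    · exact ⟨g, hg, by rw [Finset.sum_insert hp, h, hp0, single_zero, zero_add]⟩
    have hs := hB _ _ hp0
    obtain ⟨e, he, h'⟩ := exists_elementary_unit (i := p.1) (j := p.2)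
      (fun h => hs.2 (h ▸ hs.1)) (B p.1 p.2)
    refine ⟨e * g, mul_mem he hg, ?_⟩
    have hz : Matrix.single p.1 p.2 (B p.1 p.2) *
        ∑ q ∈ t, Matrix.single q.1 q.2 (B q.1 q.2) = 0 := by
      rw [Finset.mul_sum]
      refine Finset.sum_eq_zero fun q _ => ?_
      by_cases hq0 : B q.1 q.2 = 0
      · rw [hq0, single_zero, mul_zero]
      · exact single_mul_single_of_ne _ _ _ _
          (fun h : p.2 = q.1 => hs.2 (h ▸ (hB _ _ hq0).1)) _
    rw [Units.val_mul, h', h, Finset.sum_insert hp, add_mul, one_mul, mul_add, mul_one, hz]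
    abel

open Classical in
/-- The class in `K₁(R)` of an invertible matrix indexed by `Fin n` (and `1` otherwise). -/
noncomputable def finClass {n : ℕ} (M : Matrix (Fin n) (Fin n) R) : K1 R :=
  if h : IsUnit M then toK1 R n h.unit else 1

theorem finClass_coe {n : ℕ} (g : Matrix.GeneralLinearGroup (Fin n) R) :
    finClass (g : Matrix (Fin n) (Fin n) R) = toK1 R n g := by
  rw [finClass, dif_pos g.isUnit, IsUnit.unit_of_val_units]

theorem finClass_mul {n : ℕ} {M N : Matrix (Fin n) (Fin n) R} (hM : IsUnit M) (hN : IsUnit N) :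
    finClass (M * N) = finClass M * finClass N := by
  obtain ⟨g, rfl⟩ := hM
  obtain ⟨h, rfl⟩ := hN
  rw [← Units.val_mul, finClass_coe, finClass_coe, finClass_coe, map_mul]

theorem finClass_one {n : ℕ} : finClass (1 : Matrix (Fin n) (Fin n) R) = 1 := by
  rw [← Units.val_one, finClass_coe, map_one]

theorem finClass_block {n : ℕ} (s : Set (Fin n)) (B : Matrix (Fin n) (Fin n) R)
    (hB : ∀ i j, B i j ≠ 0 → i ∈ s ∧ j ∉ s) : finClass (1 + B) = 1 := by
  obtain ⟨g, hg, h⟩ := exists_elementary_block s B hB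
  rw [← h, finClass_coe, toK1_eq_one hg]

/-- The class of a matrix indexed by a sum of two standard index types. -/
noncomputable def sumClass {p q : ℕ} (M : Matrix (Fin p ⊕ Fin q) (Fin p ⊕ Fin q) R) : K1 R :=
  finClass (M.submatrix finSumFinEquiv.symm finSumFinEquiv.symm)

theorem sumClass_mul {p q : ℕ} {M N : Matrix (Fin p ⊕ Fin q) (Fin p ⊕ Fin q) R} (hM : IsUnit M)
    (hN : IsUnit N) : sumClass (M * N) = sumClass M * sumClass N := by
  rw [sumClass, ← submatrix_mul_equiv M N _ finSumFinEquiv.symm _,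
    finClass_mul (isUnit_submatrix_self hM _) (isUnit_submatrix_self hN _)]
  rfl

theorem sumClass_upper {p q : ℕ} (B : Matrix (Fin p) (Fin q) R) :
    sumClass (fromBlocks 1 B 0 1) = 1 := by
  have h : (fromBlocks 1 B 0 1 : Matrix (Fin p ⊕ Fin q) (Fin p ⊕ Fin q) R) =
      1 + fromBlocks 0 B 0 0 := by
    rw [← fromBlocks_one, fromBlocks_add]
    simp
  rw [sumClass, h, submatrix_add, Pi.add_apply, Pi.add_apply, submatrix_one_equiv]
  refine finClass_block {i | (finSumFinEquiv.symm i).isLeft} _ fun i j => ?_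
  obtain ⟨i, rfl⟩ := finSumFinEquiv.surjective i
  obtain ⟨j, rfl⟩ := finSumFinEquiv.surjective j
  rcases i with i | i <;> rcases j with j | j <;> simp

theorem sumClass_lower {p q : ℕ} (B : Matrix (Fin q) (Fin p) R) :
    sumClass (fromBlocks 1 0 B 1) = 1 := by
  have h : (fromBlocks 1 0 B 1 : Matrix (Fin p ⊕ Fin q) (Fin p ⊕ Fin q) R) =
      1 + fromBlocks 0 0 B 0 := by
    rw [← fromBlocks_one, fromBlocks_add]
    simp
  rw [sumClass, h, submatrix_add, Pi.add_apply, Pi.add_apply, submatrix_one_equiv]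
  refine finClass_block {i | (finSumFinEquiv.symm i).isRight} _ fun i j => ?_
  obtain ⟨i, rfl⟩ := finSumFinEquiv.surjective i
  obtain ⟨j, rfl⟩ := finSumFinEquiv.surjective j
  rcases i with i | i <;> rcases j with j | j <;> simp

theorem sumClass_stab {p q : ℕ} (g : Matrix.GeneralLinearGroup (Fin p) R) :
    sumClass (fromBlocks (g : Matrix (Fin p) (Fin p) R) 0 0 (1 : Matrix (Fin q) (Fin q) R)) =
      toK1 R p g := by
  rw [← toK1_stab (Nat.le_add_right p q) g, ← finClass_coe, sumClass]
  congr 1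
  ext i j
  obtain ⟨i, rfl⟩ := finSumFinEquiv.surjective i
  obtain ⟨j, rfl⟩ := finSumFinEquiv.surjective j
  have h1 (i : Fin p) (j : Fin q) : (i : ℕ) ≠ p + j := by omega
  rcases i with i | i <;> rcases j with j | j <;>
    simp [stab, stabMatrix, Matrix.one_apply, Fin.ext_iff, h1, (h1 _ _).symm]

theorem sumClass_diagonal_inv {n : ℕ} (g : Matrix.GeneralLinearGroup (Fin n) R) :
    sumClass (fromBlocks (g : Matrix (Fin n) (Fin n) R) 0 0
      ((g⁻¹ : Matrix.GeneralLinearGroup (Fin n) R) : Matrix (Fin n) (Fin n) R)) = 1 := by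
  set a : Matrix (Fin n) (Fin n) R := g.val
  set b : Matrix (Fin n) (Fin n) R := g⁻¹.val
  have hab : a * b = 1 := g.mul_inv
  have hba : b * a = 1 := g.inv_mul
  have h : (fromBlocks a 0 0 b : Matrix (Fin n ⊕ Fin n) (Fin n ⊕ Fin n) R) =
      fromBlocks 1 a 0 1 * (fromBlocks 1 0 (-b) 1 * (fromBlocks 1 a 0 1 *
        (fromBlocks 1 (-1) 0 1 * (fromBlocks 1 0 1 1 * fromBlocks 1 (-1) 0 1)))) := by
    simp [fromBlocks_multiply, hab, hba]
  have u (B : Matrix (Fin n) (Fin n) R) := isUnit_fromBlocks_one_upper B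
  have l (B : Matrix (Fin n) (Fin n) R) := isUnit_fromBlocks_one_lower B
  rw [h, sumClass_mul (u _) ((l _).mul ((u _).mul ((u _).mul ((l _).mul (u _))))),
    sumClass_mul (l _) ((u _).mul ((u _).mul ((l _).mul (u _)))),
    sumClass_mul (u _) ((u _).mul ((l _).mul (u _))), sumClass_mul (u _) ((l _).mul (u _)),
    sumClass_mul (l _) (u _)]
  simp [sumClass_upper, sumClass_lower]

theorem toK1_mul_comm {n : ℕ} (g h : Matrix.GeneralLinearGroup (Fin n) R) :
    toK1 R n g * toK1 R n h = toK1 R n h * toK1 R n g := by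
  have hd (g h : Matrix.GeneralLinearGroup (Fin n) R) :
      sumClass (fromBlocks ((g * h : Matrix.GeneralLinearGroup (Fin n) R) :
        Matrix (Fin n) (Fin n) R) 0 0 (1 : Matrix (Fin n) (Fin n) R)) =
      sumClass (fromBlocks (h : Matrix (Fin n) (Fin n) R) 0 0
        (g : Matrix (Fin n) (Fin n) R)) := by
    rw [← one_mul (sumClass _), ← sumClass_diagonal_inv g⁻¹, ← sumClass_mul]
    · simp [fromBlocks_multiply]
    · exact isUnit_fromBlocks_diagonal (Units.isUnit _) (Units.isUnit _)
    · exact isUnit_fromBlocks_diagonal (Units.isUnit _) isUnit_one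
  have he : sumClass (fromBlocks (h : Matrix (Fin n) (Fin n) R) 0 0
      (g : Matrix (Fin n) (Fin n) R)) = sumClass (fromBlocks
      ((h * g : Matrix.GeneralLinearGroup (Fin n) R) : Matrix (Fin n) (Fin n) R) 0 0
        (1 : Matrix (Fin n) (Fin n) R)) := by
    rw [← mul_one (sumClass _), ← sumClass_diagonal_inv g, ← sumClass_mul]
    · simp [fromBlocks_multiply]
    · exact isUnit_fromBlocks_diagonal (Units.isUnit _) (Units.isUnit _)
    · exact isUnit_fromBlocks_diagonal (Units.isUnit _) (Units.isUnit _)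
  rw [← map_mul, ← map_mul, ← sumClass_stab (q := n), hd, he, sumClass_stab]

theorem K1.mul_comm' (x y : K1 R) : x * y = y * x := by
  obtain ⟨n, g, rfl⟩ := exists_toK1_eq x
  obtain ⟨m, h, rfl⟩ := exists_toK1_eq y
  rw [← toK1_stab (le_max_left n m) g, ← toK1_stab (le_max_right n m) h, toK1_mul_comm]

theorem finClass_submatrix_perm {n : ℕ} {M : Matrix (Fin n) (Fin n) R} (hM : IsUnit M)
    (e : Fin n ≃ Fin n) : finClass (M.submatrix e e) = finClass M := by
  have h1 : (1 : Matrix (Fin n) (Fin n) R).submatrix e id *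
      (1 : Matrix (Fin n) (Fin n) R).submatrix id e = 1 := by
    rw [← Equiv.coe_refl, submatrix_mul_equiv, mul_one, submatrix_one_equiv]
  have h2 : (1 : Matrix (Fin n) (Fin n) R).submatrix id e *
      (1 : Matrix (Fin n) (Fin n) R).submatrix e id = 1 := by
    rw [submatrix_mul_equiv, mul_one, submatrix_id_id]
  have hP : IsUnit ((1 : Matrix (Fin n) (Fin n) R).submatrix e id) := ⟨⟨_, _, h1, h2⟩, rfl⟩
  have hQ : IsUnit ((1 : Matrix (Fin n) (Fin n) R).submatrix id e) := ⟨⟨_, _, h2, h1⟩, rfl⟩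
  have h : M.submatrix e e = (1 : Matrix (Fin n) (Fin n) R).submatrix e id * M *
      (1 : Matrix (Fin n) (Fin n) R).submatrix id e := by
    have h3 : M = M.submatrix id id := (submatrix_id_id M).symm
    conv_rhs => rw [h3, ← Equiv.coe_refl, submatrix_mul_equiv, submatrix_mul_equiv]
    simp
  rw [h, finClass_mul (hP.mul hM) hQ, finClass_mul hP hM, K1.mul_comm' (finClass _) (finClass M),
    mul_assoc, ← finClass_mul hP hQ, h1, finClass_one, mul_one]

section

variable {ι κ : Type*} [Fintype ι] [Fintype κ] [DecidableEq ι] [DecidableEq κ]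

/-- The class in `K₁(R)` of an invertible square matrix with arbitrary finite index type. -/
noncomputable def matClass (M : Matrix ι ι R) : K1 R :=
  finClass (M.submatrix (Fintype.equivFin ι).symm (Fintype.equivFin ι).symm)

theorem matClass_eq_finClass {M : Matrix ι ι R} (hM : IsUnit M) {n : ℕ} (e : Fin n ≃ ι) :
    matClass M = finClass (M.submatrix e e) := by
  obtain rfl : Fintype.card ι = n := by simpa using (Fintype.card_congr e).symm
  rw [matClass, ← finClass_submatrix_perm (isUnit_submatrix_self hM _)
    (e.trans (Fintype.equivFin ι)), submatrix_submatrix]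
  congr 2 <;> ext <;> simp

theorem matClass_mul {M N : Matrix ι ι R} (hM : IsUnit M) (hN : IsUnit N) :
    matClass (M * N) = matClass M * matClass N := by
  rw [matClass, ← submatrix_mul_equiv M N _ (Fintype.equivFin ι).symm _,
    finClass_mul (isUnit_submatrix_self hM _) (isUnit_submatrix_self hN _)]
  rfl

theorem matClass_one : matClass (1 : Matrix ι ι R) = 1 := by
  rw [matClass, submatrix_one_equiv, finClass_one]

theorem matClass_pow {M : Matrix ι ι R} (hM : IsUnit M) (k : ℕ) :
    matClass (M ^ k) = matClass M ^ k := by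
  induction k with
  | zero => simp [matClass_one]
  | succ k ih => rw [pow_succ, matClass_mul (hM.pow k) hM, ih, pow_succ]

theorem matClass_coe {n : ℕ} (g : Matrix.GeneralLinearGroup (Fin n) R) :
    matClass (g : Matrix (Fin n) (Fin n) R) = toK1 R n g := by
  rw [matClass_eq_finClass g.isUnit (Equiv.refl _), ← finClass_coe]
  rfl

theorem matClass_submatrix {M : Matrix ι ι R} (hM : IsUnit M) (e : κ ≃ ι) :
    matClass (M.submatrix e e) = matClass M := by
  rw [matClass_eq_finClass hM ((Fintype.equivFin κ).symm.trans e), matClass, submatrix_submatrix]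
  rfl

theorem matClass_fromBlocks_eq_sumClass {M : Matrix (ι ⊕ κ) (ι ⊕ κ) R} (hM : IsUnit M) :
    matClass M = sumClass (M.submatrix
      (Equiv.sumCongr (Fintype.equivFin ι).symm (Fintype.equivFin κ).symm)
      (Equiv.sumCongr (Fintype.equivFin ι).symm (Fintype.equivFin κ).symm)) := by
  rw [matClass_eq_finClass hM (finSumFinEquiv.symm.trans
    (Equiv.sumCongr (Fintype.equivFin ι).symm (Fintype.equivFin κ).symm)), sumClass,
    submatrix_submatrix]
  rfl

theorem matClass_one_upper (B : Matrix ι κ R) :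
    matClass (fromBlocks 1 B 0 1) = 1 := by
  rw [matClass_fromBlocks_eq_sumClass (isUnit_fromBlocks_one_upper B),
    ← sumClass_upper (B.submatrix (Fintype.equivFin ι).symm (Fintype.equivFin κ).symm)]
  congr 1
  ext (i | i) (j | j) <;> simp [Matrix.one_apply]

theorem matClass_one_lower (B : Matrix κ ι R) :
    matClass (fromBlocks 1 0 B 1) = 1 := by
  rw [matClass_fromBlocks_eq_sumClass (isUnit_fromBlocks_one_lower B),
    ← sumClass_lower (B.submatrix (Fintype.equivFin κ).symm (Fintype.equivFin ι).symm)]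
  congr 1
  ext (i | i) (j | j) <;> simp [Matrix.one_apply]

theorem matClass_diagonal_one {A : Matrix ι ι R} (hA : IsUnit A) :
    matClass (fromBlocks A 0 0 (1 : Matrix κ κ R)) = matClass A := by
  have hA' := isUnit_submatrix_self hA (Fintype.equivFin ι).symm
  rw [matClass_fromBlocks_eq_sumClass (isUnit_fromBlocks_diagonal hA isUnit_one), matClass]
  obtain ⟨g, hg⟩ := hA'
  rw [← hg, finClass_coe, ← sumClass_stab (q := Fintype.card κ), hg]
  congr 1
  ext (i | i) (j | j) <;> simp [Matrix.one_apply]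

theorem matClass_diagonal {A : Matrix ι ι R} {D : Matrix κ κ R} (hA : IsUnit A) (hD : IsUnit D) :
    matClass (fromBlocks A 0 0 D) = matClass A * matClass D := by
  have h : fromBlocks A 0 0 D = fromBlocks A 0 0 (1 : Matrix κ κ R) *
      (fromBlocks D 0 0 (1 : Matrix ι ι R)).submatrix (Equiv.sumComm ι κ) (Equiv.sumComm ι κ) := by
    simp [fromBlocks_multiply]
  have hD' := isUnit_fromBlocks_diagonal hD (isUnit_one (M := Matrix ι ι R))
  rw [h, matClass_mul (isUnit_fromBlocks_diagonal hA isUnit_one) (isUnit_submatrix_self hD' _),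
    matClass_submatrix hD', matClass_diagonal_one hA, matClass_diagonal_one hD]

theorem matClass_upper {A : Matrix ι ι R} {B : Matrix ι κ R} {D : Matrix κ κ R} (hA : IsUnit A)
    (hD : IsUnit D) : matClass (fromBlocks A B 0 D) = matClass A * matClass D := by
  obtain ⟨B', h⟩ := fromBlocks_upper_eq_mul (A := A) (B := B) hD
  rw [h, matClass_mul (isUnit_fromBlocks_one_upper B') (isUnit_fromBlocks_diagonal hA hD),
    matClass_one_upper, one_mul, matClass_diagonal hA hD]

theorem matClass_lower {A : Matrix ι ι R} {B : Matrix κ ι R} {D : Matrix κ κ R} (hA : IsUnit A)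
    (hD : IsUnit D) : matClass (fromBlocks A 0 B D) = matClass A * matClass D := by
  obtain ⟨B', h⟩ := fromBlocks_lower_eq_mul (B := B) (D := D) hA
  rw [h, matClass_mul (isUnit_fromBlocks_one_lower B') (isUnit_fromBlocks_diagonal hA hD),
    matClass_one_lower, one_mul, matClass_diagonal hA hD]

end

/-! ### Matrices with matrix entries -/

section

variable {n ι κ : Type*} [Fintype n] [Fintype ι] [Fintype κ] [DecidableEq n] [DecidableEq ι]
  [DecidableEq κ]

/-- The class in `K₁(R)` of an invertible block matrix, whose entries are square matrices. -/
noncomputable def blockClass (M : Matrix ι ι (Matrix n n R)) : K1 R :=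
  matClass (Matrix.comp ι ι n n R M)

theorem isUnit_comp {M : Matrix ι ι (Matrix n n R)} (hM : IsUnit M) :
    IsUnit (Matrix.comp ι ι n n R M) :=
  hM.map (Matrix.compRingEquiv ι n R)

theorem blockClass_mul {M N : Matrix ι ι (Matrix n n R)} (hM : IsUnit M) (hN : IsUnit N) :
    blockClass (M * N) = blockClass M * blockClass N := by
  rw [blockClass, blockClass, blockClass, ← matClass_mul (isUnit_comp hM) (isUnit_comp hN)]
  exact congrArg matClass (map_mul (Matrix.compRingEquiv ι n R) M N)

theorem blockClass_one : blockClass (1 : Matrix ι ι (Matrix n n R)) = 1 := by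
  rw [blockClass, Matrix.comp_one, matClass_one]

theorem blockClass_pow {M : Matrix ι ι (Matrix n n R)} (hM : IsUnit M) (k : ℕ) :
    blockClass (M ^ k) = blockClass M ^ k := by
  rw [blockClass, blockClass, ← matClass_pow (isUnit_comp hM)]
  exact congrArg matClass (map_pow (Matrix.compRingEquiv ι n R) M k)

theorem blockClass_submatrix {M : Matrix ι ι (Matrix n n R)} (hM : IsUnit M) (e : κ ≃ ι) :
    blockClass (M.submatrix e e) = blockClass M :=
  matClass_submatrix (isUnit_comp hM) (e.prodCongr (Equiv.refl n))

theorem blockClass_congr_of_mul_eq {M N U : Matrix ι ι (Matrix n n R)} (hM : IsUnit M)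
    (hN : IsUnit N) (hU : IsUnit U) (h : M * U = U * N) : blockClass M = blockClass N := by
  have := congrArg blockClass h
  rw [blockClass_mul hM hU, blockClass_mul hU hN, K1.mul_comm'] at this
  exact mul_left_cancel this

theorem comp_fromBlocks {R n ι κ : Type*} (A : Matrix ι ι (Matrix n n R)) (B : Matrix ι κ (Matrix n n R))
    (C : Matrix κ ι (Matrix n n R)) (D : Matrix κ κ (Matrix n n R)) :
    Matrix.comp _ _ n n R (fromBlocks A B C D) =
      (fromBlocks (Matrix.comp _ _ n n R A) (Matrix.comp _ _ n n R B) (Matrix.comp _ _ n n R C)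
        (Matrix.comp _ _ n n R D)).submatrix (Equiv.sumProdDistrib ι κ n)
          (Equiv.sumProdDistrib ι κ n) := by
  ext ⟨i | i, k⟩ ⟨j | j, l⟩ <;> rfl

theorem blockClass_upper {A : Matrix ι ι (Matrix n n R)} {B : Matrix ι κ (Matrix n n R)}
    {D : Matrix κ κ (Matrix n n R)} (hA : IsUnit A) (hD : IsUnit D) :
    blockClass (fromBlocks A B 0 D) = blockClass A * blockClass D := by
  rw [blockClass, comp_fromBlocks, matClass_submatrix]
  · exact matClass_upper (isUnit_comp hA) (isUnit_comp hD)
  · exact isUnit_fromBlocks_upper (isUnit_comp hA) (isUnit_comp hD)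

theorem blockClass_lower {A : Matrix ι ι (Matrix n n R)} {B : Matrix κ ι (Matrix n n R)}
    {D : Matrix κ κ (Matrix n n R)} (hA : IsUnit A) (hD : IsUnit D) :
    blockClass (fromBlocks A 0 B D) = blockClass A * blockClass D := by
  rw [blockClass, comp_fromBlocks, matClass_submatrix]
  · exact matClass_lower (isUnit_comp hA) (isUnit_comp hD)
  · exact isUnit_fromBlocks_lower (isUnit_comp hA) (isUnit_comp hD)

theorem blockClass_unique [Unique ι] {M : Matrix ι ι (Matrix n n R)} (hM : IsUnit M) :
    blockClass M = matClass (M default default) := by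
  rw [blockClass, ← matClass_submatrix (isUnit_comp hM) (Equiv.uniqueProd n ι).symm]
  rfl

end

end WhiteheadK

namespace WhiteheadK

open Matrix PowerSeries

section

variable {S : Type*} [Ring S]

/-- The entries of the companion matrix of an invertible power series `a`: the first column is
`-aᵢ₊₁ a₀⁻¹`, and the rest is the shift. -/
noncomputable def companionEntry (a : S⟦X⟧ˣ) (i j : ℕ) : S :=
  if j = 0 then -(coeff (i + 1) a.val * coeff 0 a⁻¹.val) else if i + 1 = j then 1 else 0

/-- The companion matrix of size `d` of an invertible power series. -/
noncomputable def companion (a : S⟦X⟧ˣ) (d : ℕ) : Matrix (Fin d) (Fin d) S :=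
  of fun i j => companionEntry a i j

theorem companionEntry_zero (a : S⟦X⟧ˣ) (i : ℕ) :
    companionEntry a i 0 = -(coeff (i + 1) a.val * coeff 0 a⁻¹.val) :=
  if_pos rfl

theorem companionEntry_succ (a : S⟦X⟧ˣ) (i j : ℕ) :
    companionEntry a i (j + 1) = if i = j then 1 else 0 := by
  simp [companionEntry]

theorem companionEntry_one (i j : ℕ) :
    companionEntry (1 : S⟦X⟧ˣ) i j = if i + 1 = j then 1 else 0 := by
  rcases j with _ | j
  · simp [companionEntry, coeff_one]
  · simp [companionEntry_succ]

theorem coeff_zero_mul_coeff_zero (a b : S⟦X⟧) : coeff 0 (a * b) = coeff 0 a * coeff 0 b := by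
  simp

theorem coeff_zero_mul_inv (a : S⟦X⟧ˣ) : coeff 0 a.val * coeff 0 a⁻¹.val = 1 := by
  rw [← coeff_zero_mul_coeff_zero, a.mul_inv, coeff_zero_one]

theorem sum_companionEntry_mul (a : S⟦X⟧ˣ) (i : ℕ) {m : ℕ} (hm : 0 < m) (x : ℕ → S)
    (hx : ∀ l, m ≤ l → x l = 0) :
    ∑ l ∈ Finset.range m, companionEntry a i l * x l =
      x (i + 1) - coeff (i + 1) a.val * coeff 0 a⁻¹.val * x 0 := by
  obtain ⟨m, rfl⟩ := Nat.exists_eq_succ_of_ne_zero hm.ne'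
  rw [Finset.sum_range_succ', companionEntry_zero, neg_mul, ← sub_eq_add_neg]
  congr 1
  simp only [companionEntry_succ, ite_mul, one_mul, zero_mul, Finset.sum_ite_eq, Finset.mem_range]
  split_ifs with h
  · rfl
  · exact (hx _ (by omega)).symm

theorem sum_coeff_X_pow_mul (a : S⟦X⟧) (i q : ℕ) (y : S⟦X⟧)
    (hy : ∀ l, q ≤ l → l ≤ i → coeff l y = 0) :
    ∑ l ∈ Finset.range q, coeff i (X ^ l * a) * coeff l y = coeff i (a * y) := by
  have h1 : ∑ l ∈ Finset.range q, coeff i (X ^ l * a) * coeff l y =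
      ∑ l ∈ Finset.range (max q (i + 1)), coeff i (X ^ l * a) * coeff l y := by
    refine Finset.sum_subset (Finset.range_subset_range.2 (le_max_left _ _)) fun l _ hl => ?_
    rw [Finset.mem_range, not_lt] at hl
    by_cases hli : l ≤ i
    · rw [hy l hl hli, mul_zero]
    · rw [coeff_X_pow_mul', if_neg hli, zero_mul]
  have h2 : ∑ l ∈ Finset.range (i + 1), coeff i (X ^ l * a) * coeff l y =
      ∑ l ∈ Finset.range (max q (i + 1)), coeff i (X ^ l * a) * coeff l y := by
    refine Finset.sum_subset (Finset.range_subset_range.2 (le_max_right _ _)) fun l _ hl => ?_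
    rw [Finset.mem_range, not_lt] at hl
    rw [coeff_X_pow_mul', if_neg (by omega), zero_mul]
  rw [h1, ← h2, coeff_mul, ← Finset.Nat.sum_antidiagonal_swap,
    Finset.Nat.sum_antidiagonal_eq_sum_range_succ_mk]
  refine Finset.sum_congr rfl fun l hl => ?_
  rw [coeff_X_pow_mul', if_pos (Nat.lt_succ_iff.1 (Finset.mem_range.1 hl))]
  rfl

theorem coeff_succ_mul_eq (a b : S⟦X⟧) (i : ℕ) :
    coeff (i + 1) (a * b) = coeff (i + 1) a * coeff 0 b +
      coeff i (a * mk fun l => coeff (l + 1) b) := by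
  rw [coeff_mul, coeff_mul, Finset.Nat.sum_antidiagonal_succ']
  simp only [coeff_mk]

/-- The Sylvester matrix of `a` and `X ^ q`: its first `q` columns are shifts of `a`, the others
are standard basis vectors. -/
noncomputable def sylvester (a : S⟦X⟧) (q p : ℕ) : Matrix (Fin q ⊕ Fin p) (Fin q ⊕ Fin p) S :=
  fromBlocks (of fun i j => coeff (i : ℕ) (X ^ (j : ℕ) * a)) 0
    (of fun i j => coeff (q + i : ℕ) (X ^ (j : ℕ) * a)) 1

theorem isUnit_sylvester (a : S⟦X⟧ˣ) (q p : ℕ) : IsUnit (sylvester a.val q p) := by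
  have h (a b : S⟦X⟧) (hab : a * b = 1) :
      (of fun i j : Fin q => coeff (i : ℕ) (X ^ (j : ℕ) * a)) *
        (of fun i j : Fin q => coeff (i : ℕ) (X ^ (j : ℕ) * b)) = 1 := by
    ext i j
    rw [mul_apply]
    simp only [of_apply]
    rw [Fin.sum_univ_eq_sum_range
      (fun l => coeff (i : ℕ) (X ^ l * a) * coeff l (X ^ (j : ℕ) * b)) q,
      sum_coeff_X_pow_mul, ← mul_assoc, (commute_X_pow a j).eq, mul_assoc, hab, mul_one,
      coeff_X_pow]
    · simp only [one_apply, Fin.ext_iff]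
    intro l hl hl'
    omega
  exact isUnit_fromBlocks_lower ⟨⟨_, _, h _ _ a.mul_inv, h _ _ a.inv_mul⟩, rfl⟩ isUnit_one

/-- The upper right block that appears when the companion matrix of a product is brought to block
triangular form. -/
noncomputable def companionCorner (a : S⟦X⟧ˣ) (q p : ℕ) : Matrix (Fin q) (Fin p) S :=
  of fun i j => if (i : ℕ) + 1 = q ∧ (j : ℕ) = 0 then coeff 0 a⁻¹.val else 0

theorem companion_mul_sylvester (a b : S⟦X⟧ˣ) {q p : ℕ} (hq : 0 < q)
    (ha : ∀ i, p < i → coeff i a.val = 0) (hb : ∀ i, q < i → coeff i b.val = 0) :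
    (companion (a * b) (q + p)).submatrix finSumFinEquiv finSumFinEquiv * sylvester a.val q p =
      sylvester a.val q p * fromBlocks (companion b q) (companionCorner a q p) 0
        (companion a p) := by
  have hinv : coeff 0 (a * b)⁻¹.val = coeff 0 b⁻¹.val * coeff 0 a⁻¹.val := by
    rw [_root_.mul_inv_rev, Units.val_mul, coeff_zero_mul_coeff_zero]
  have hleft (i : ℕ) (j : Fin q) :
      ∑ l ∈ Finset.range (q + p), companionEntry (a * b) i l * coeff l (X ^ (j : ℕ) * a.val) =
        ∑ l : Fin q, coeff i (X ^ (l : ℕ) * a.val) * companionEntry b l j := by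
    rw [sum_companionEntry_mul _ _ (by omega), Fin.sum_univ_eq_sum_range
      (fun l => coeff i (X ^ l * a.val) * companionEntry b l j) q]
    · obtain ⟨_ | j, hj⟩ := j
      · have hs := sum_coeff_X_pow_mul a.val i q (mk fun l => coeff (l + 1) b.val) (by
          intro l hl _
          rw [coeff_mk, hb _ (by omega)])
        simp only [coeff_mk] at hs
        simp only [companionEntry_zero, mul_neg, Finset.sum_neg_distrib, ← mul_assoc,
          ← Finset.sum_mul, hs, pow_zero, one_mul, Units.val_mul, coeff_succ_mul_eq, hinv]
        have h1 := coeff_zero_mul_inv b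
        have h2 : coeff 0 a⁻¹.val * coeff 0 a.val = 1 := by
          simpa using coeff_zero_mul_inv a⁻¹
        rw [mul_assoc _ (coeff 0 a⁻¹.val), h2, mul_one, add_mul, mul_assoc, h1, mul_one]
        abel
      · simp only [companionEntry_succ, mul_ite, mul_one, mul_zero]
        rw [Finset.sum_ite_eq', if_pos (Finset.mem_range.2 (by omega)), pow_succ', mul_assoc,
          coeff_succ_X_mul, coeff_zero_X_mul, mul_zero, sub_zero]
    · intro l hl
      rw [coeff_X_pow_mul']
      split_ifs
      · exact ha _ (by omega)
      · rfl
  have hright (i : ℕ) (j : Fin p) (hi : i < q + p):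
      companionEntry (a * b) i (q + j) =
        (∑ l : Fin q, coeff i (X ^ (l : ℕ) * a.val) * companionCorner a q p l j) +
          if q ≤ i then companionEntry a (i - q) j else 0 := by
    obtain ⟨q, rfl⟩ := Nat.exists_eq_succ_of_ne_zero hq.ne'
    obtain ⟨_ | j, hj⟩ := j
    · have hs : ∑ l : Fin (q + 1), coeff i (X ^ (l : ℕ) * a.val) *
          companionCorner a (q + 1) p l ⟨0, hj⟩ =
            coeff i (X ^ q * a.val) * coeff 0 a⁻¹.val := by
        rw [Finset.sum_eq_single (Fin.last q)]
        · simp [companionCorner]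
        · intro l _ hl
          have : (l : ℕ) ≠ q := fun h => hl (Fin.ext h)
          simp [companionCorner, this]
        · simp
      rw [hs, add_zero, companionEntry_succ, companionEntry_zero, coeff_X_pow_mul']
      rcases lt_trichotomy i q with h | rfl | h
      · simp [h.ne, h.not_ge, (Nat.lt_succ_of_lt h).not_ge]
      · simp only [if_true, le_refl, Nat.sub_self, coeff_zero_mul_inv]
        simp
      · have h1 : i - (q + 1) + 1 = i - q := by omega
        simp [h.ne', h.le, Nat.succ_le_iff.2 h, h1]
    · have hs : ∑ l : Fin (q + 1), coeff i (X ^ (l : ℕ) * a.val) *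
          companionCorner a (q + 1) p l ⟨j + 1, hj⟩ = 0 := by
        refine Finset.sum_eq_zero fun l _ => ?_
        simp [companionCorner]
      rw [hs, zero_add, ← add_assoc, companionEntry_succ, companionEntry_succ]
      split_ifs <;> first | rfl | omega
  have hz (i : Fin q) (l : Fin p) : (i : ℕ) ≠ q + l := by omega
  ext i j
  rw [mul_apply, mul_apply, Fintype.sum_sum_type, Fintype.sum_sum_type]
  rcases j with j | j
  · have := hleft (finSumFinEquiv i) j
    rw [← Fin.sum_univ_eq_sum_range
      (fun l => companionEntry (a * b) (finSumFinEquiv i) l * coeff l (X ^ (j : ℕ) * a.val)),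
      Fin.sum_univ_add] at this
    rcases i with i | i <;> simpa [sylvester, companion] using this
  · have := hright (finSumFinEquiv i) j (Fin.is_lt _)
    rcases i with i | i
    · simpa [sylvester, companion, Matrix.one_apply, i.2.not_ge] using this
    · simpa [sylvester, companion, Matrix.one_apply] using this

theorem isNilpotent_companion_one (d : ℕ) : IsNilpotent (companion (1 : S⟦X⟧ˣ) d) := by
  have h (m : ℕ) : ∀ i j : Fin d, (j : ℕ) < i + m → (companion (1 : S⟦X⟧ˣ) d ^ m) i j = 0 := by
    induction m with
    | zero =>
      intro i j h
      rw [pow_zero, one_apply_ne]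
      rintro rfl
      omega
    | succ m ih =>
      intro i j h
      rw [pow_succ, mul_apply]
      refine Finset.sum_eq_zero fun l _ => ?_
      by_cases hl : (l : ℕ) < i + m
      · rw [ih _ _ hl, zero_mul]
      · rw [companion, of_apply, companionEntry_one, if_neg (by omega), mul_zero]
  refine ⟨d, ?_⟩
  ext i j
  exact h d i j (by omega)

theorem isNilpotent_submatrix {m n : Type*} [Fintype m] [Fintype n] [DecidableEq m]
    [DecidableEq n] {M : Matrix m m S} (hM : IsNilpotent M) (e : n ≃ m) :
    IsNilpotent (M.submatrix e e) :=
  hM.map (reindexRingEquiv S e.symm)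

theorem isNilpotent_of_mul_eq_mul {A : Type*} [Ring A] {P Q U : A} (hU : IsUnit U)
    (h : P * U = U * Q) (hP : IsNilpotent P) : IsNilpotent Q := by
  obtain ⟨m, hm⟩ := hP
  refine ⟨m, hU.mul_left_cancel ?_⟩
  rw [← pow_mul_eq_mul_pow_of_mul_eq_mul h, hm, zero_mul, mul_zero]

theorem isNilpotent_companion (a : S⟦X⟧ˣ) {p q : ℕ} (ha : ∀ i, p < i → coeff i a.val = 0)
    (ha' : ∀ i, q < i → coeff i a⁻¹.val = 0) : IsNilpotent (companion a p) := by
  have h := companion_mul_sylvester a a⁻¹ q.succ_pos ha fun i hi => ha' i (by omega)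
  rw [mul_inv_cancel] at h
  have := isNilpotent_of_mul_eq_mul (isUnit_sylvester a _ p) h
    (isNilpotent_submatrix (isNilpotent_companion_one _) _)
  exact (exists_nilEval_fromBlocks_upper (C := ℤ) 1 this).2.1

theorem fromBlocks_mul_one_sub_smul_companion (a : S⟦X⟧ˣ) (y : Subring.center S) (d : ℕ) :
    fromBlocks (1 : Matrix (Fin 1) (Fin 1) S) (of fun _ (j : Fin d) => (y : S) ^ ((j : ℕ) + 1)) 0
        (1 : Matrix (Fin d) (Fin d) S) *
      (1 - y • companion a (1 + d)).submatrix finSumFinEquiv finSumFinEquiv =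
    fromBlocks (of fun _ _ => (∑ i ∈ Finset.range (d + 2), (y : S) ^ i * coeff i a.val) *
        coeff 0 a⁻¹.val) 0
      (of fun (i : Fin d) _ => (y : S) * coeff ((i : ℕ) + 2) a.val * coeff 0 a⁻¹.val)
      (1 - y • companion 1 d) := by
  have hM : (1 - y • companion a (1 + d)).submatrix finSumFinEquiv finSumFinEquiv =
      fromBlocks (of fun _ _ => 1 + (y : S) * (coeff 1 a.val * coeff 0 a⁻¹.val))
        (of fun _ (j : Fin d) => if (j : ℕ) = 0 then -(y : S) else 0)
        (of fun (i : Fin d) _ => (y : S) * coeff ((i : ℕ) + 2) a.val * coeff 0 a⁻¹.val)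
        (1 - y • companion 1 d) := by
    have h2 (j : Fin d) : Fin.castAdd d (0 : Fin 1) ≠ Fin.natAdd 1 j := by
      simp [Fin.ext_iff]; omega
    ext (i | i) (j | j)
    · obtain rfl : i = 0 := Subsingleton.elim _ _
      obtain rfl : j = 0 := Subsingleton.elim _ _
      simp [companion, companionEntry_zero, Subring.smul_def]
    · obtain rfl : i = 0 := Subsingleton.elim _ _
      have : companionEntry a 0 (1 + j) = if (j : ℕ) = 0 then 1 else 0 := by
        rw [add_comm, companionEntry_succ]
        simp only [eq_comm]
      simp only [submatrix_apply, finSumFinEquiv_apply_left, finSumFinEquiv_apply_right, Matrix.sub_apply,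
        one_apply_ne (h2 j), Matrix.smul_apply, companion, of_apply, fromBlocks_apply₁₂, Fin.val_castAdd,
        Fin.val_natAdd, Fin.val_zero, this, Subring.smul_def, smul_eq_mul]
      split_ifs <;> simp
    · obtain rfl : j = 0 := Subsingleton.elim _ _
      simp [companion, companionEntry_zero, Subring.smul_def, one_apply_ne (h2 i).symm, mul_assoc,
        show 1 + (i : ℕ) + 1 = i + 2 by omega]
    · have : companionEntry a (1 + i) (1 + j) = companionEntry 1 i j := by
        rw [add_comm 1 (j : ℕ), companionEntry_succ, companionEntry_one, add_comm]
      simp [companion, one_apply, this]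
  rw [hM, fromBlocks_multiply]
  congr 1
  · ext i j
    simp only [Matrix.one_mul, Matrix.add_apply, mul_apply, of_apply]
    rw [Fin.sum_univ_eq_sum_range
      (fun j => (y : S) ^ (j + 1) * ((y : S) * coeff (j + 2) a.val * coeff 0 a⁻¹.val)),
      Finset.sum_range_succ', Finset.sum_range_succ', add_mul, add_mul, pow_zero, one_mul,
      coeff_zero_mul_inv, Finset.sum_mul]
    simp only [add_assoc, Nat.reduceAdd, zero_add, pow_zero, one_mul, pow_succ, mul_assoc]
    rw [add_comm (y * (_ * _) : S), add_comm, add_assoc]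
  · ext i j
    simp only [Matrix.one_mul, Matrix.add_apply, mul_apply, of_apply, Matrix.zero_apply]
    have (l : Fin d) : (y : S) ^ ((l : ℕ) + 1) * (1 - y • companion 1 d : Matrix _ _ S) l j =
        (if l = j then (y : S) ^ ((l : ℕ) + 1) else 0) -
          if (l : ℕ) + 1 = j then (y : S) ^ ((l : ℕ) + 2) else 0 := by
      rw [Matrix.sub_apply, Matrix.smul_apply, companion, of_apply, companionEntry_one, one_apply,
        Subring.smul_def, smul_eq_mul, pow_succ _ ((l : ℕ) + 1)]
      simp [mul_sub]
    simp only [this, Finset.sum_sub_distrib, Finset.sum_ite_eq', Finset.mem_univ, if_true]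
    obtain ⟨_ | j, hj⟩ := j
    · simp
    · rw [Finset.sum_eq_single ⟨j, by omega⟩]
      · simp
      · intro l _ hl
        rw [if_neg]
        exact fun h => hl (Fin.ext (by simpa using h))
      · simp
  · simp
  · simp

end

end WhiteheadK

namespace WhiteheadK

open Matrix PowerSeries

section

variable {R C n : Type*} [Ring R] [CommRing C] [Algebra C R] [Fintype n] [DecidableEq n]

/-- The class of `f (y N)` in `K₁(R)`, where `N` is the companion matrix of a power series over a
matrix ring over `R` and `y` is central. -/
noncomputable def companionClass (f : C⟦X⟧) (y : Subring.center (Matrix n n R))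
    (a : (Matrix n n R)⟦X⟧ˣ) (d : ℕ) : K1 R :=
  blockClass (f.nilEval (y • companion a d))

theorem isNilpotent_smul_of_isNilpotent {Z A : Type*} [CommRing Z] [Ring A] [Algebra Z A] (y : Z)
    {P : A} (hP : IsNilpotent P) : IsNilpotent (y • P) := by
  obtain ⟨m, hm⟩ := hP
  exact ⟨m, by rw [smul_pow, hm, smul_zero]⟩

theorem companionClass_mul {f : C⟦X⟧} (hf : constantCoeff f = 1)
    (y : Subring.center (Matrix n n R)) (a b : (Matrix n n R)⟦X⟧ˣ) {q p : ℕ} (hq : 0 < q)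
    (ha : ∀ i, p < i → coeff i a.val = 0) (hb : ∀ i, q < i → coeff i b.val = 0)
    (hab : IsNilpotent (companion (a * b) (q + p))) :
    companionClass f y (a * b) (q + p) = companionClass f y b q * companionClass f y a p := by
  have hf' : IsUnit (constantCoeff f) := hf ▸ isUnit_one
  have hU := isUnit_sylvester a q p
  have h : (y • companion (a * b) (q + p)).submatrix finSumFinEquiv finSumFinEquiv *
      sylvester a.val q p = sylvester a.val q p * fromBlocks (y • companion b q)
        (y • companionCorner a q p) 0 (y • companion a p) := by
    have h0 : fromBlocks (y • companion b q) (y • companionCorner a q p) 0 (y • companion a p) =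
        y • fromBlocks (companion b q) (companionCorner a q p) 0 (companion a p) := by
      rw [fromBlocks_smul, smul_zero]
    rw [h0, mul_smul_comm, ← companion_mul_sylvester a b hq ha hb, ← smul_mul_assoc]
    rfl
  have hP := isNilpotent_smul_of_isNilpotent y hab
  have hP' := isNilpotent_submatrix hP finSumFinEquiv
  have hQ := isNilpotent_of_mul_eq_mul hU h hP'
  obtain ⟨hb', ha', K, hK⟩ := exists_nilEval_fromBlocks_upper f hQ
  have he : (f.nilEval (y • companion (a * b) (q + p))).submatrix finSumFinEquiv finSumFinEquiv =
      f.nilEval ((y • companion (a * b) (q + p)).submatrix finSumFinEquiv finSumFinEquiv) := by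
    exact (nilEval_algHom f
      (reindexAlgEquiv C (Matrix n n R) finSumFinEquiv.symm).toAlgHom hP).symm
  rw [companionClass, ← blockClass_submatrix (isUnit_nilEval hf' hP) finSumFinEquiv, he,
    blockClass_congr_of_mul_eq (isUnit_nilEval hf' hP') (isUnit_nilEval hf' hQ) hU
      (nilEval_mul_eq_mul_nilEval f hP' hQ h), hK,
    blockClass_upper (isUnit_nilEval hf' hb') (isUnit_nilEval hf' ha')]
  rfl

theorem companionClass_one {f : C⟦X⟧} (hf : constantCoeff f = 1)
    (y : Subring.center (Matrix n n R)) (d : ℕ) : companionClass f y 1 d = 1 := by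
  have h1 (p : ℕ) (i : ℕ) (hi : p < i) : coeff i (1 : (Matrix n n R)⟦X⟧ˣ).val = 0 := by
    rw [Units.val_one, coeff_one, if_neg (by omega)]
  have h0 : companion (1 : (Matrix n n R)⟦X⟧ˣ) 1 = 0 := by
    ext1 i j
    rw [companion, of_apply, companionEntry_one, if_neg (by omega), Matrix.zero_apply]
  have hc : companionClass f y 1 1 = 1 := by
    rw [companionClass, h0, smul_zero, nilEval_zero, hf, one_smul, blockClass_one]
  induction d with
  | zero => rw [companionClass, Subsingleton.elim (f.nilEval _) 1, blockClass_one]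
  | succ d ih =>
    have h := companionClass_mul hf y 1 1 one_pos (h1 d) (h1 1)
      (by rw [mul_one]; exact isNilpotent_companion_one _)
    rwa [mul_one, hc, ih, one_mul, add_comm] at h

theorem companionClass_eq_of_le {f : C⟦X⟧} (hf : constantCoeff f = 1)
    (y : Subring.center (Matrix n n R)) (a : (Matrix n n R)⟦X⟧ˣ) {p d : ℕ} (hpd : p ≤ d)
    (ha : ∀ i, p < i → coeff i a.val = 0) (hn : IsNilpotent (companion a d)) :
    companionClass f y a d = companionClass f y a p := by
  obtain rfl | hlt := hpd.eq_or_lt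
  · rfl
  obtain ⟨q, rfl⟩ := Nat.exists_eq_add_of_le' hpd
  have h := companionClass_mul hf y a 1 (q := q) (by omega) ha (fun i hi => by
    rw [Units.val_one, coeff_one, if_neg (by omega)]) (by rwa [mul_one])
  rwa [mul_one, companionClass_one hf, one_mul] at h

theorem companionClass_pow {f : C⟦X⟧} (hf : constantCoeff f = 1)
    (y : Subring.center (Matrix n n R)) (a : (Matrix n n R)⟦X⟧ˣ) {d : ℕ}
    (hn : IsNilpotent (companion a d)) (k : ℕ) :
    companionClass f y a d ^ k = companionClass (f ^ k) y a d := by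
  have hn' := isNilpotent_smul_of_isNilpotent y hn
  rw [companionClass, companionClass, nilEval_pow _ hn',
    blockClass_pow (isUnit_nilEval (hf ▸ isUnit_one) hn')]

theorem isUnit_of_fin_one {S : Type*} [Ring S] {u : S} (hu : IsUnit u) :
    IsUnit (of fun _ _ : Fin 1 => u) := by
  obtain ⟨u, rfl⟩ := hu
  refine ⟨⟨of fun _ _ => u.1, of fun _ _ => u.2, ?_, ?_⟩, rfl⟩ <;> ext1 i j <;>
    rw [Subsingleton.elim i j] <;> simp [mul_apply]

theorem blockClass_eq_of_upper_mul_eq_lower {ι κ : Type*} [Fintype ι] [Fintype κ] [DecidableEq ι]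
    [DecidableEq κ] {V : Matrix ι κ (Matrix n n R)} {M : Matrix (ι ⊕ κ) (ι ⊕ κ) (Matrix n n R)}
    {A : Matrix ι ι (Matrix n n R)} {B : Matrix κ ι (Matrix n n R)}
    {D : Matrix κ κ (Matrix n n R)} (hM : IsUnit M) (hA : IsUnit A) (hD : IsUnit D)
    (h : fromBlocks 1 V 0 1 * M = fromBlocks A 0 B D) :
    blockClass M = blockClass A * blockClass D := by
  have key := congrArg blockClass h
  rwa [blockClass_mul (isUnit_fromBlocks_one_upper V) hM, blockClass_upper isUnit_one isUnit_one,
    blockClass_one, blockClass_one, one_mul, one_mul, blockClass_lower hA hD] at key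

theorem companionClass_one_sub_X (y : Subring.center (Matrix n n R)) (a : (Matrix n n R)⟦X⟧ˣ)
    {d : ℕ} (hn : IsNilpotent (companion a (1 + d))) {s : Matrix n n R} (hu : IsUnit s)
    (hs : ∑ i ∈ Finset.range (d + 2), (y : Matrix n n R) ^ i * coeff i a.val = s) :
    companionClass (1 - X : C⟦X⟧) y a (1 + d) = matClass (s * coeff 0 a⁻¹.val) := by
  have hf : constantCoeff (1 - X : C⟦X⟧) = 1 := by simp
  have hf' : IsUnit (constantCoeff (1 - X : C⟦X⟧)) := hf ▸ isUnit_one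
  have hn' := isNilpotent_smul_of_isNilpotent y hn
  have hn1 := isNilpotent_smul_of_isNilpotent y
    (isNilpotent_companion_one (S := Matrix n n R) d)
  have hu0 : IsUnit (coeff 0 a⁻¹.val) :=
    ⟨⟨_, _, by simpa using coeff_zero_mul_inv a⁻¹, coeff_zero_mul_inv a⟩, rfl⟩
  have hI := isUnit_nilEval hf' hn'
  have hI1 := isUnit_nilEval hf' hn1
  have h1 := companionClass_one hf y d
  have hF := fromBlocks_mul_one_sub_smul_companion a y d
  rw [hs] at hF
  rw [companionClass, nilEval_one_sub_X hn1] at h1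
  rw [nilEval_one_sub_X hn'] at hI
  rw [nilEval_one_sub_X hn1] at hI1
  have hT := isUnit_of_fin_one (hu.mul hu0)
  have key := blockClass_eq_of_upper_mul_eq_lower (isUnit_submatrix_self hI _) hT hI1 hF
  rw [h1, mul_one, blockClass_submatrix hI, blockClass_unique hT] at key
  rw [companionClass, nilEval_one_sub_X hn', key]
  rfl

end

section

variable {R : Type*} [Ring R] {n : Type*} [Fintype n] [DecidableEq n]

/-- A matrix over `R[X]`, viewed as a power series whose coefficients are constant matrices. -/
noncomputable def coeffSeries : Matrix n n (Polynomial R) →* (Matrix n n (Polynomial R))⟦X⟧ where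
  toFun A := mk fun i => A.map fun p => Polynomial.C (p.coeff i)
  map_one' := by
    ext k i j
    by_cases h : i = j <;> by_cases hk : k = 0 <;>
      simp [coeff_one, one_apply, Polynomial.coeff_one, h, hk]
  map_mul' A B := by
    ext1 k
    rw [coeff_mul]
    ext1 i j
    simp only [coeff_mk, map_apply, mul_apply, Polynomial.finsetSum_coeff, Polynomial.coeff_mul,
      map_sum, map_mul, Matrix.sum_apply]
    rw [Finset.sum_comm]

theorem coeff_coeffSeries (A : Matrix n n (Polynomial R)) (i : ℕ) :
    coeff i (coeffSeries A) = A.map fun p => Polynomial.C (p.coeff i) := by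
  simp [coeffSeries]

theorem exists_coeffSeries_bound (A : Matrix n n (Polynomial R)) :
    ∃ d, (∀ i j, (A i j).natDegree ≤ d) ∧ ∀ m, d < m → coeff m (coeffSeries A) = 0 := by
  refine ⟨Finset.univ.sup fun p : n × n => (A p.1 p.2).natDegree, fun i j =>
    Finset.le_sup (f := fun p : n × n => (A p.1 p.2).natDegree) (Finset.mem_univ (i, j)),
    fun m hm => ?_⟩
  ext1 i j
  rw [coeff_coeffSeries, map_apply, Polynomial.coeff_eq_zero_of_natDegree_lt, map_zero, Matrix.zero_apply]
  exact (Finset.le_sup (f := fun p : n × n => (A p.1 p.2).natDegree)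
    (Finset.mem_univ (i, j))).trans_lt hm

/-- The indeterminate, as a central scalar matrix. -/
noncomputable def centralX : Subring.center (Matrix n n (Polynomial R)) :=
  ⟨scalar n Polynomial.X, Subring.mem_center_iff.2 fun A =>
    (scalar_commute _ (fun _ => Polynomial.X_mul) A).symm⟩

theorem sum_centralX_pow_mul (A : Matrix n n (Polynomial R)) {d : ℕ}
    (hd : ∀ i j, (A i j).natDegree < d) :
    ∑ i ∈ Finset.range d, (centralX (R := R) (n := n) : Matrix n n (Polynomial R)) ^ i *
      coeff i (coeffSeries A) = A := by
  ext1 i j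
  conv_rhs => rw [Polynomial.as_sum_range_C_mul_X_pow' (A i j) (hd i j)]
  rw [Matrix.sum_apply]
  refine Finset.sum_congr rfl fun m _ => ?_
  rw [centralX, ← map_pow, coeff_coeffSeries, scalar_apply, diagonal_mul, map_apply,
    Polynomial.X_pow_mul]

end

end WhiteheadK

namespace WhiteheadK

open Matrix PowerSeries

section

variable {R : Type*} [Ring R]

theorem elementary_le_ker {G : Type*} [Group G] (hG : ∀ x y : G, x * y = y * x) {n : ℕ}
    (hn : 3 ≤ n) (φ : Matrix.GeneralLinearGroup (Fin n) R →* G) : elementary R n ≤ φ.ker := by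
  refine (Subgroup.closure_le _).2 ?_
  rintro g ⟨i, j, c, hij, hg⟩
  obtain ⟨l, hl⟩ : ∃ l : Fin n, l ∉ ({i, j} : Finset (Fin n)) := by
    by_contra! h
    have := Finset.card_le_card (fun l _ => h l : Finset.univ ⊆ ({i, j} : Finset (Fin n)))
    have h2 := Finset.card_le_two (a := i) (b := j)
    rw [Finset.card_univ, Fintype.card_fin] at this
    omega
  simp only [Finset.mem_insert, Finset.mem_singleton, not_or] at hl
  obtain ⟨e, -, he⟩ := exists_elementary_unit (Ne.symm hl.1) c
  obtain ⟨e', -, he'⟩ := exists_elementary_unit hl.2 (1 : R)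
  have h : g * e' * e = e * e' := by
    ext1
    simp only [Units.val_mul, hg, he, he']
    simp only [mul_add, add_mul, mul_one, one_mul, single_mul_single_same]
    rw [single_mul_single_of_ne _ _ _ _ (Ne.symm hl.2), single_mul_single_of_ne _ _ _ _ hij.symm,
      single_mul_single_of_ne _ _ _ _ hij.symm]
    simp only [zero_mul, add_zero]
    abel
  have := congrArg φ h
  rw [map_mul, map_mul, map_mul, mul_assoc, hG (φ e') (φ e)] at this
  exact mul_eq_right.1 this

theorem exists_stab_eq {n m : ℕ} {g : Matrix.GeneralLinearGroup (Fin n) R}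
    {h : Matrix.GeneralLinearGroup (Fin m) R} (hgh : toStable R n g = toStable R m h) :
    ∃ N, ∃ (h₁ : n ≤ N) (h₂ : m ≤ N), stab R n N h₁ g = stab R m N h₂ h := by
  obtain ⟨N, h₁, h₂, e⟩ := Quotient.exact hgh
  exact ⟨N, h₁, h₂, e⟩

variable {C n : Type*} [CommRing C] [Algebra C R] [Fintype n] [DecidableEq n]

theorem exists_coeffSeries_bound_units (A : (Matrix n n (Polynomial R))ˣ) :
    ∃ d, (∀ i j, (A.val i j).natDegree ≤ d) ∧
      (∀ m, d < m → coeff m (Units.map coeffSeries A).val = 0) ∧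
      ∀ m, d < m → coeff m (Units.map coeffSeries A)⁻¹.val = 0 := by
  obtain ⟨d, h, hd⟩ := exists_coeffSeries_bound A.val
  obtain ⟨d', -, hd'⟩ := exists_coeffSeries_bound A⁻¹.val
  exact ⟨max d d', fun i j => (h i j).trans (le_max_left _ _),
    fun m hm => hd m ((le_max_left _ _).trans_lt hm),
    fun m hm => hd' m ((le_max_right _ _).trans_lt hm)⟩

/-- A bound for the degrees of the entries of an invertible polynomial matrix and of its inverse. -/
noncomputable def degreeBound (A : (Matrix n n (Polynomial R))ˣ) : ℕ :=
  (exists_coeffSeries_bound_units A).choose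

theorem natDegree_le_degreeBound (A : (Matrix n n (Polynomial R))ˣ) (i j : n) :
    (A.val i j).natDegree ≤ degreeBound A :=
  (exists_coeffSeries_bound_units A).choose_spec.1 i j

theorem coeff_eq_zero_of_degreeBound_lt (A : (Matrix n n (Polynomial R))ˣ) {m : ℕ}
    (hm : degreeBound A < m) : coeff m (Units.map coeffSeries A).val = 0 :=
  (exists_coeffSeries_bound_units A).choose_spec.2.1 m hm

theorem isNilpotent_companion_coeffSeries (A : (Matrix n n (Polynomial R))ˣ) {d : ℕ}
    (hd : degreeBound A ≤ d) : IsNilpotent (companion (Units.map coeffSeries A) d) :=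
  isNilpotent_companion _ (fun _ hi => coeff_eq_zero_of_degreeBound_lt A (hd.trans_lt hi))
    (exists_coeffSeries_bound_units A).choose_spec.2.2

theorem companionClass_coeffSeries_eq {f : C⟦X⟧} (hf : constantCoeff f = 1)
    (A : (Matrix n n (Polynomial R))ˣ) {d : ℕ} (hd : degreeBound A ≤ d) :
    companionClass f centralX (Units.map coeffSeries A) d =
      companionClass f centralX (Units.map coeffSeries A) (degreeBound A) :=
  companionClass_eq_of_le hf _ _ hd (fun _ hi => coeff_eq_zero_of_degreeBound_lt A hi)
    (isNilpotent_companion_coeffSeries A hd)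

/-- The operation of a power series `f` with constant coefficient `1` on matrices over `R[X]`. -/
noncomputable def wittAction (f : C⟦X⟧) (hf : constantCoeff f = 1) :
    (Matrix n n (Polynomial R))ˣ →* K1 (Polynomial R) :=
  MonoidHom.mk' (fun A => companionClass f centralX (Units.map coeffSeries A) (degreeBound A)) <| by
    intro A B
    have hA : degreeBound A ≤ degreeBound A + degreeBound (A * B) := Nat.le_add_right _ _
    have hB : degreeBound B ≤ degreeBound B + 1 := Nat.le_succ _
    have hAB : degreeBound (A * B) ≤
        degreeBound B + 1 + (degreeBound A + degreeBound (A * B)) := by omega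
    have h := companionClass_mul hf centralX (Units.map coeffSeries A) (Units.map coeffSeries B)
      (Nat.succ_pos (degreeBound B))
      (fun _ hi => coeff_eq_zero_of_degreeBound_lt A (hA.trans_lt hi))
      (fun _ hi => coeff_eq_zero_of_degreeBound_lt B (hB.trans_lt hi))
      (by rw [← map_mul]; exact isNilpotent_companion_coeffSeries _ hAB)
    rw [← map_mul, companionClass_coeffSeries_eq hf _ hAB, companionClass_coeffSeries_eq hf _ hA,
      companionClass_coeffSeries_eq hf _ hB, K1.mul_comm'] at h
    exact h

theorem wittAction_pow {f g : C⟦X⟧} (hf : constantCoeff f = 1) (hg : constantCoeff g = 1) {k : ℕ}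
    (h : f ^ k = g) (A : (Matrix n n (Polynomial R))ˣ) :
    wittAction f hf A ^ k = wittAction g hg A := by
  subst h
  exact companionClass_pow hf _ _ (isNilpotent_companion_coeffSeries A le_rfl) k

theorem wittAction_one_sub_X (h : constantCoeff (1 - X : C⟦X⟧) = 1) {n : ℕ}
    (A : Matrix.GeneralLinearGroup (Fin n) (Polynomial R)) :
    wittAction (1 - X : C⟦X⟧) h A = toK1 _ n A * (K1.map Polynomial.C
      (K1.map (Polynomial.constantCoeff : Polynomial R →+* R) (toK1 _ n A)))⁻¹ := by
  have hd : degreeBound A ≤ 1 + degreeBound A := Nat.le_add_left _ _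
  have h0 : coeff 0 (Units.map coeffSeries A)⁻¹.val =
      (glMap Polynomial.C n (glMap Polynomial.constantCoeff n A⁻¹)).val := by
    rw [← map_inv, Units.coe_map]
    exact (coeff_coeffSeries _ _).trans rfl
  change companionClass _ _ _ _ = _
  rw [← companionClass_coeffSeries_eq h A hd, companionClass_one_sub_X centralX _
    (isNilpotent_companion_coeffSeries A hd) A.isUnit (sum_centralX_pow_mul A.val fun i j =>
      (natDegree_le_degreeBound A i j).trans_lt (by omega)), h0, ← Units.val_mul, matClass_coe,
    map_mul, map_toK1, map_toK1, ← map_inv, map_inv, map_inv]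

theorem eq_one_of_mem_NK1_of_pow_eq_one {k : ℕ} (hk : IsUnit (k : C)) {x : K1 (Polynomial R)}
    (hx : x ∈ NK1 R) (hxk : x ^ k = 1) : x = 1 := by
  obtain ⟨f, hfk, hf⟩ := PowerSeries.exists_pow_eq_one_sub_X k hk
  have h1 : constantCoeff (1 - X : C⟦X⟧) = 1 := by simp
  obtain ⟨n₀, g, rfl⟩ := exists_toK1_eq x
  rw [← map_pow, toK1_eq_one_iff] at hxk
  obtain ⟨m, e, he, heq⟩ := hxk
  obtain ⟨N, hm, hn, hst⟩ := exists_stab_eq heq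
  have hN := le_max_left N 3
  set A := stab (Polynomial R) n₀ (max N 3) (hn.trans hN) g with hA
  have hAk : A ^ k ∈ elementary (Polynomial R) (max N 3) := by
    have := stab_mem_elementary hN (stab_mem_elementary hm he)
    rw [hst, map_pow, map_pow] at this
    convert this using 2
    exact (DirectedSystem.map_map (f := fun n m h => stab (Polynomial R) n m h) hn hN g).symm
  have hAx : toK1 _ _ A = toK1 _ _ g := toK1_stab _ g
  have hw : wittAction f hf A ^ k = 1 := by
    rw [← map_pow]
    exact elementary_le_ker K1.mul_comm' (le_max_right N 3) (wittAction f hf) hAk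
  rw [wittAction_pow hf h1 hfk, wittAction_one_sub_X, hAx, MonoidHom.mem_ker.1 hx, map_one, inv_one,
    mul_one] at hw
  exact hw

end

end WhiteheadK

theorem theorem1 {R : Type*} [Ring R] (k : ℤ) (hk : IsUnit (k : R)) :
    ∀ x ∈ WhiteheadK.NK1 R, x ^ k = 1 → x = 1 := by
  intro x hx hxk
  have hk' : IsUnit ((k.natAbs : ℕ) : Subring.center R) := by
    obtain ⟨u, hu⟩ : IsUnit ((k.natAbs : ℕ) : R) := by
      rcases Int.natAbs_eq k with h | h <;> rw [h] at hk <;> simpa using hk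
    have hc : u⁻¹.val ∈ Subring.center R := by
      refine Subring.mem_center_iff.2 fun r => ?_
      have : Commute u.val r := hu ▸ Nat.cast_commute _ _
      exact this.units_inv_left.eq.symm
    refine ⟨⟨(k.natAbs : ℕ), ⟨_, hc⟩, ?_, ?_⟩, rfl⟩ <;> ext <;> simp [← hu, -Nat.cast_natAbs]
  refine WhiteheadK.eq_one_of_mem_NK1_of_pow_eq_one hk' hx ?_
  rcases Int.natAbs_eq k with h | h
  · rwa [h, zpow_natCast] at hxk
  · rwa [h, zpow_neg, zpow_natCast, inv_eq_one] at hxk
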